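/- Let $\sigma_s,\sigma_n,\sigma_{n_z}>0$ with $\sigma_n^2\le\sigma_{n_z}^2$ and let $P\ge 0$; $\log$ is to base $2$ and mutual information is in bits. Let $S(1),S(2),\dots$ be i.i.d. $\mathcal N(0,\sigma_s^2)$. A (possibly randomized) encoder of block length $n$ chooses the input $X^n$ by a conditional distribution given the whole state sequence $S^n$, and two receivers observe $$Y(i)=X(i)+S(i)+N(i),\qquad Z(i)=X(i)+S(i)+N_z(i),$$ where the pairs $(N(i),N_z(i))$ are i.i.d., independent of $(S^n,X^n)$, with $N(i)\sim\mathcal N(0,\sigma_n^2)$ and $N_z(i)\sim\mathcal N(0,\sigma_{n_z}^2)$ and an arbitrary joint law. A pair $(R_a,R_l)\in\mathbb R^2$ is achievable if there is a sequence of encoders such that for every $\epsilon>0$ and all sufficiently large $n$, $$\tfrac1n\sum_{i=1}^n\mathbb E[X(i)^2]\le P,\qquad \tfrac1n I(S^n;Y^n)\ge R_a-\epsilon,\qquad \tfrac1n I(S^n;Z^n)\le R_l+\epsilon .$$ Let $\mathcal C$ be the set of achievable pairs and let $C_d=\sup_{(R_a,R_l)\in\mathcal C}(R_a-R_l)$ be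 the differential amplification capacity. Then $$C_d=\frac12\log\Bigl(1+\frac{(\sigma_s+\sqrt P)^2}{\sigma_n^2}\Bigr)-\frac12\log\Bigl(1+\frac{(\sigma_s+\sqrt P)^2}{\sigma_{n_z}^2}\Bigr).$$ The supremum is attained by uncoded transmission: for every $n\ge1$ the encoder $X(i)=\frac{\sqrt P}{\sigma_s}S(i)$ satisfies the power constraint and gives $\frac1n I(S^n;Y^n)=\frac12\log\bigl(1+\frac{(\sigma_s+\sqrt P)^2}{\sigma_n^2}\bigr)$ and $\frac1n I(S^n;Z^n)=\frac12\log\bigl(1+\frac{(\sigma_s+\sqrt P)^2}{\sigma_{n_z}^2}\bigr)$, and this pair of values belongs to $\mathcal C$. Moreover $C_d$ equals the maximum of the single-letter quantity $I(X,S;Y|Z)$ over all conditional distributions of $X$ given $S\sim\mathcal N(0,\sigma_s^2)$ with $\mathbb E[X^2]\le P$, where $Y=X+S+N$ and $Z=Y+N'$ with $N\sim\mathcal N(0,\sigma_n^2)$, $N'\sim\mathcal N(0,\sigma_{n_z}^2-\sigma_n^2)$ independent of each other and of $(X,S)$; this maximum is attained at $X=\frac{\sqrt P}{\sigma_s}S$.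 -/

import Mathlib

open MeasureTheory ProbabilityTheory Filter
open scoped ENNReal

namespace StateAmplification

/-- Mutual information `I(U;V)` of two random variables, in bits: the Kullback-Leibler divergence
of the joint law from the product of the marginals (`klDiv` is in nats). -/
noncomputable def mutualInfo {Ω α β : Type*} [MeasurableSpace Ω] [MeasurableSpace α]
    [MeasurableSpace β] (U : Ω → α) (V : Ω → β) (μ : Measure Ω) : ℝ≥0∞ :=
  InformationTheory.klDiv (μ.map fun ω => (U ω, V ω)) ((μ.map U).prod (μ.map V))
    / ENNReal.ofReal (Real.log 2)

/-- Conditional mutual information `I(U;V|T)`, in bits: the Kullback-Leibler divergence of the joint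
law of `(T, (U, V))` from the law under which `T` has its own distribution and, given `T`, the
variables `U` and `V` are independent with their conditional distributions. -/
noncomputable def condMutualInfo {Ω α β γ : Type*} [MeasurableSpace Ω]
    [MeasurableSpace α] [StandardBorelSpace α] [Nonempty α]
    [MeasurableSpace β] [StandardBorelSpace β] [Nonempty β] [MeasurableSpace γ]
    (U : Ω → α) (V : Ω → β) (T : Ω → γ) (μ : Measure Ω) [IsFiniteMeasure μ] : ℝ≥0∞ :=
  InformationTheory.klDiv (μ.map fun ω => (T ω, (U ω, V ω)))
      ((μ.map T) ⊗ₘ ((condDistrib U T μ) ×ₖ (condDistrib V T μ)))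
    / ENNReal.ofReal (Real.log 2)

/-- The centred Gaussian law with standard deviation `σ`. -/
noncomputable abbrev gauss (σ : ℝ) : Measure ℝ := gaussianReal 0 (σ ^ 2).toNNReal

/-- Sample space of one block of length `n`: a point is `((s, x), w)`, with `s` the state sequence,
`x` the channel input and `w i` the pair of the two receivers' noises at time `i`. -/
abbrev Block (n : ℕ) : Type := ((Fin n → ℝ) × (Fin n → ℝ)) × (Fin n → ℝ × ℝ)

/-- Joint law of a block: the state is i.i.d. Gaussian, the input is drawn from the whole state
sequence by the (possibly randomized) encoder `κ`, and the noise pairs are i.i.d. with law `ν`,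
independent of state and input. -/
noncomputable def blockLaw (σs : ℝ) (ν : Measure (ℝ × ℝ)) {n : ℕ}
    (κ : Kernel (Fin n → ℝ) (Fin n → ℝ)) : Measure (Block n) :=
  ((Measure.pi fun _ : Fin n => gauss σs) ⊗ₘ κ).prod (Measure.pi fun _ : Fin n => ν)

/-- The state sequence. -/
def stateSeq {n : ℕ} (ω : Block n) : Fin n → ℝ := ω.1.1

/-- The input sequence. -/
def inputSeq {n : ℕ} (ω : Block n) : Fin n → ℝ := ω.1.2

/-- The legitimate receiver's output. -/
def bobSeq {n : ℕ} (ω : Block n) : Fin n → ℝ :=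
  fun i => inputSeq ω i + stateSeq ω i + (ω.2 i).1

/-- The eavesdropper's output. -/
def eveSeq {n : ℕ} (ω : Block n) : Fin n → ℝ :=
  fun i => inputSeq ω i + stateSeq ω i + (ω.2 i).2

/-- The normalized information about the state at the legitimate receiver. -/
noncomputable def amplificationRate (σs : ℝ) (ν : Measure (ℝ × ℝ)) {n : ℕ}
    (κ : Kernel (Fin n → ℝ) (Fin n → ℝ)) : ℝ≥0∞ :=
  mutualInfo stateSeq bobSeq (blockLaw σs ν κ) / n

/-- The normalized information about the state at the eavesdropper. -/
noncomputable def leakageRate (σs : ℝ) (ν : Measure (ℝ × ℝ)) {n : ℕ}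
    (κ : Kernel (Fin n → ℝ) (Fin n → ℝ)) : ℝ≥0∞ :=
  mutualInfo stateSeq eveSeq (blockLaw σs ν κ) / n

/-- The average transmitted power. -/
noncomputable def averagePower (σs : ℝ) (ν : Measure (ℝ × ℝ)) {n : ℕ}
    (κ : Kernel (Fin n → ℝ) (Fin n → ℝ)) : ℝ≥0∞ :=
  (∑ i, ∫⁻ ω, ENNReal.ofReal (inputSeq ω i ^ 2) ∂(blockLaw σs ν κ)) / n

/-- The set of achievable amplification-leakage pairs `(R_a, R_l)` under the power constraint `P`.
The comparisons are in the extended reals, so that a negative `R_l` is never achievable. -/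
def achievableRegion (σs : ℝ) (ν : Measure (ℝ × ℝ)) (P : ℝ) : Set (ℝ × ℝ) :=
  {R | ∃ κ : (n : ℕ) → Kernel (Fin n → ℝ) (Fin n → ℝ), (∀ n, IsMarkovKernel (κ n)) ∧
    ∀ ε : ℝ, 0 < ε → ∀ᶠ n in atTop,
      averagePower σs ν (κ n) ≤ ENNReal.ofReal P ∧
      ((R.1 - ε : ℝ) : EReal) ≤ (amplificationRate σs ν (κ n) : EReal) ∧
      (leakageRate σs ν (κ n) : EReal) ≤ ((R.2 + ε : ℝ) : EReal)}

/-- The differential amplification capacity: the supremum of `R_a - R_l` over the achievable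
pairs. -/
noncomputable def diffAmpCapacity (σs : ℝ) (ν : Measure (ℝ × ℝ)) (P : ℝ) : EReal :=
  sSup ((fun R : ℝ × ℝ => ((R.1 - R.2 : ℝ) : EReal)) '' achievableRegion σs ν P)

/-- The uncoded scheme `X(i) = (√P / σs) S(i)`. -/
noncomputable def uncoded (σs P : ℝ) (n : ℕ) : Kernel (Fin n → ℝ) (Fin n → ℝ) :=
  Kernel.deterministic (fun s i => Real.sqrt P / σs * s i) (by fun_prop)

/-- Single-letter law of `((S, X), (N, N'))`: Gaussian state, input drawn by `κ` from the state, and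
independent Gaussian `N`, `N'` with variances `σn²` and `σz² - σn²`. -/
noncomputable def letterLaw (σs σn σz : ℝ) (κ : Kernel ℝ ℝ) : Measure ((ℝ × ℝ) × (ℝ × ℝ)) :=
  (gauss σs ⊗ₘ κ).prod ((gauss σn).prod (gaussianReal 0 (σz ^ 2 - σn ^ 2).toNNReal))

instance (σs σn σz : ℝ) (κ : Kernel ℝ ℝ) [IsMarkovKernel κ] :
    IsProbabilityMeasure (letterLaw σs σn σz κ) := by
  unfold letterLaw; infer_instance

/-- `I(X,S;Y|Z)` for `Y = X + S + N` and the degraded output `Z = Y + N'`. -/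
noncomputable def letterCondInfo (σs σn σz : ℝ) (κ : Kernel ℝ ℝ) [IsMarkovKernel κ] : ℝ≥0∞ :=
  condMutualInfo (fun ω : (ℝ × ℝ) × (ℝ × ℝ) => (ω.1.2, ω.1.1))
    (fun ω => ω.1.2 + ω.1.1 + ω.2.1) (fun ω => ω.1.2 + ω.1.1 + ω.2.1 + ω.2.2)
    (letterLaw σs σn σz κ)

/-- The second moment `E X²` of the single-letter input. -/
noncomputable def letterPower (σs : ℝ) (κ : Kernel ℝ ℝ) : ℝ≥0∞ :=
  ∫⁻ ω, ENNReal.ofReal (ω.2 ^ 2) ∂(gauss σs ⊗ₘ κ)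

/-- The single-letter uncoded input `X = (√P / σs) S`. -/
noncomputable def letterUncoded (σs P : ℝ) : Kernel ℝ ℝ :=
  Kernel.deterministic (fun s => Real.sqrt P / σs * s) (by fun_prop)

instance (σs P : ℝ) : IsMarkovKernel (letterUncoded σs P) := by
  unfold letterUncoded; infer_instance

/-- `½ log₂ (1 + (σs + √P)² / σ²)`. -/
noncomputable def coherentRate (σs P σ : ℝ) : ℝ :=
  1 / 2 * Real.logb 2 (1 + (σs + Real.sqrt P) ^ 2 / σ ^ 2)

end StateAmplification

/-! Put `W = X + S`, let `s ≤ t` be the two noise variances, and let `Q = (σs + √P)²`, the largest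
power that `W` can have. Each mutual information depends only on the law of state, input and one
output, so the joint law of the noises may be replaced by any coupling with the same marginals. The
converse uses the backward one: the eavesdropper's noise `N_z` comes first, and the other receiver's
noise is `(s/t) N_z` plus an independent Gaussian.

Let `R` be the Gaussian channel that produces `Y` from `Z` by linear estimation when `W` has power
`Q`. Data processing and the chain rule give `I(S;Y) ≤ I(S;Z) + D(P_{TZY} ‖ P_{TZ} ⊗ R)` with `T =
(S, X)` (`klDiv_prod_le_add`). Given `T` and `Z`, both the true `Y` and the reference are Gaussian,
so this divergence is an explicit affine function of the power of `W` (`klDiv_backward`): it equals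
`n/2 · log((1 + Q/s)/(1 + Q/t))` at power `nQ` and is nondecreasing in the power. By Cauchy-Schwarz
the power is at most `nQ` (`sum_integral_add_sq_le`). No differential entropy and no maximum-entropy
argument is needed. Uncoded transmission makes everything jointly Gaussian, and its two rates are
computed directly (`klDiv_uncoded`).

For one letter the same divergence splits exactly as `D(P_{ZY} ‖ P_Z ⊗ R) + I(X,S;Y|Z)`
(`klDiv_condDistrib_add`). This bounds the conditional information for every input. For the uncoded
input, `R` is the true backward channel and the power is `Q`, so the slack term vanishes and the
bound is attained. -/

namespace StateAmplification

open scoped NNReal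
open InformationTheory

/-! ### Gaussian densities on product spaces -/

/-- The reference is a Gaussian probability measure instead of Lebesgue measure, so that the
one-dimensional densities multiply under products of probability measures. The quotient is
legitimate because a nondegenerate Gaussian density is positive and finite. -/
lemma gaussianReal_eq_withDensity_gaussianReal (m m' : ℝ) {v v' : ℝ≥0} (hv : v ≠ 0)
    (hv' : v' ≠ 0) :
    gaussianReal m v = (gaussianReal m' v').withDensity
      (fun x => gaussianPDF m v x / gaussianPDF m' v' x) := by
  have h := withDensity_mul volume (measurable_gaussianPDF m' v')
    ((measurable_gaussianPDF m v).div (measurable_gaussianPDF m' v'))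
  rw [gaussianReal_of_var_ne_zero m hv, gaussianReal_of_var_ne_zero m' hv']
  refine Eq.trans ?_ h
  congr 1
  ext x
  simp only [Pi.mul_apply, Pi.div_apply]
  rw [ENNReal.mul_div_cancel (gaussianPDF_pos m' hv' x).ne' gaussianPDF_ne_top]

lemma lintegral_pi_prod {ι : Type*} [Fintype ι] {ρ : ι → Measure ℝ}
    [∀ i, IsProbabilityMeasure (ρ i)] {f : ι → ℝ → ℝ≥0∞} (hf : ∀ i, Measurable (f i)) :
    ∫⁻ x, ∏ i, f i (x i) ∂(Measure.pi ρ) = ∏ i, ∫⁻ x, f i x ∂(ρ i) := by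
  have hind : iIndepFun (fun i (x : ι → ℝ) => f i (x i)) (Measure.pi ρ) :=
    iIndepFun_pi (X := f) (fun i => (hf i).aemeasurable)
  have h := lintegral_prod_eq_prod_lintegral_of_indepFun Finset.univ
    (fun i (x : ι → ℝ) => f i (x i)) hind (fun i => (hf i).comp (measurable_pi_apply i))
  rw [h]
  refine Finset.prod_congr rfl fun i _ => ?_
  have := (measurePreserving_eval ρ i).lintegral_comp (hf i)
  simpa using this

lemma pi_withDensity {ι : Type*} [Fintype ι] {ρ : ι → Measure ℝ}
    [∀ i, IsProbabilityMeasure (ρ i)] {f : ι → ℝ → ℝ≥0∞} (hf : ∀ i, Measurable (f i))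
    [∀ i, SigmaFinite ((ρ i).withDensity (f i))] :
    Measure.pi (fun i => (ρ i).withDensity (f i)) =
      (Measure.pi ρ).withDensity (fun x => ∏ i, f i (x i)) := by
  refine (Measure.pi_eq fun s hs => ?_)
  rw [withDensity_apply _ (MeasurableSet.univ_pi hs),
    ← lintegral_indicator (MeasurableSet.univ_pi hs)]
  have : ∀ x : ι → ℝ, (Set.univ.pi s).indicator (fun x => ∏ i, f i (x i)) x
      = ∏ i, (s i).indicator (f i) (x i) := by
    intro x
    by_cases hx : x ∈ Set.univ.pi s
    · rw [Set.indicator_of_mem hx]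
      exact Finset.prod_congr rfl fun i _ => (Set.indicator_of_mem (hx i trivial) _).symm
    · rw [Set.indicator_of_notMem hx]
      simp only [Set.mem_pi, Set.mem_univ, forall_const, not_forall] at hx
      obtain ⟨i, hi⟩ := hx
      exact (Finset.prod_eq_zero (Finset.mem_univ i) (Set.indicator_of_notMem hi _)).symm
  simp_rw [this]
  rw [lintegral_pi_prod fun i => (hf i).indicator (hs i)]
  refine Finset.prod_congr rfl fun i _ => ?_
  rw [withDensity_apply _ (hs i), lintegral_indicator (hs i)]

/-- The law of `n` independent centred Gaussian variables of variance `v`. -/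
noncomputable abbrev noise (ι : Type*) [Fintype ι] (v : ℝ≥0) : Measure (ι → ℝ) :=
  Measure.pi fun _ => gaussianReal 0 v

lemma noise_map_const_add {ι : Type*} [Fintype ι] (v : ℝ≥0) (d : ι → ℝ) :
    (noise ι v).map (fun e => d + e) = Measure.pi fun i => gaussianReal (d i) v := by
  have h := Measure.pi_map_pi (μ := fun _ : ι => gaussianReal 0 v)
    (f := fun i x => d i + x) (fun i => by fun_prop)
  have h2 : ∀ i, (gaussianReal 0 v).map (fun x => d i + x) = gaussianReal (d i) v := by
    intro i; rw [gaussianReal_map_const_add]; simp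
  simp_rw [h2] at h
  exact h

lemma pi_gaussianReal_eq_withDensity {ι : Type*} [Fintype ι] {v v' : ℝ≥0} (hv : v ≠ 0)
    (hv' : v' ≠ 0) (d : ι → ℝ) :
    Measure.pi (fun i => gaussianReal (d i) v) = (noise ι v').withDensity
      (fun y => ∏ i, gaussianPDF (d i) v (y i) / gaussianPDF 0 v' (y i)) := by
  have h2 : ∀ i, gaussianReal (d i) v = (gaussianReal 0 v').withDensity
      (fun x => gaussianPDF (d i) v x / gaussianPDF 0 v' x) := fun i =>
    gaussianReal_eq_withDensity_gaussianReal _ _ hv hv'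
  have : ∀ i, SigmaFinite ((gaussianReal 0 v').withDensity
      (fun x => gaussianPDF (d i) v x / gaussianPDF 0 v' x)) := fun i => by
    rw [← h2 i]; infer_instance
  have hm : ∀ i, Measurable fun x => gaussianPDF (d i) v x / gaussianPDF 0 v' x := fun i =>
    (measurable_gaussianPDF _ _).div (measurable_gaussianPDF _ _)
  rw [← pi_withDensity hm]
  congr 1
  ext1 i
  exact h2 i

lemma measurable_shear_density {ι A : Type*} [Fintype ι] [MeasurableSpace A] (v v' : ℝ≥0)
    {d : A → ι → ℝ} (hd : Measurable d) :
    Measurable fun p : A × (ι → ℝ) =>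
      ∏ i, gaussianPDF (d p.1 i) v (p.2 i) / gaussianPDF 0 v' (p.2 i) := by
  refine Finset.measurable_prod _ fun i _ => Measurable.div ?_ ?_
  · exact measurable_uncurry_gaussianPDF.comp
      (f := fun p : A × (ι → ℝ) => (d p.1 i, v, p.2 i)) (by fun_prop)
  · exact (measurable_gaussianPDF 0 v').comp (by fun_prop)

/-- Densities transfer along fibres: if every fibre image of the noise has a density, so has the
joint law. -/
lemma prod_map_shear_eq_withDensity {A B : Type*} [MeasurableSpace A] [MeasurableSpace B]
    [Add B] [MeasurableAdd₂ B] (μ : Measure A) [SFinite μ] (ρ ρ' : Measure B) [SFinite ρ]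
    [SFinite ρ'] {d : A → B} (hd : Measurable d) {f : A × B → ℝ≥0∞} (hf : Measurable f)
    (h : ∀ a, ρ.map (fun e => d a + e) = ρ'.withDensity fun y => f (a, y)) :
    (μ.prod ρ).map (fun p => (p.1, d p.1 + p.2)) = (μ.prod ρ').withDensity f := by
  have hs : Measurable fun p : A × B => (p.1, d p.1 + p.2) := by fun_prop
  refine Measure.ext_of_lintegral _ fun g hg => ?_
  rw [lintegral_map hg hs, lintegral_withDensity_eq_lintegral_mul _ hf hg,
    lintegral_prod (fun p : A × B => g (p.1, d p.1 + p.2)) (hg.comp hs).aemeasurable,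
    lintegral_prod _ (hf.mul hg).aemeasurable]
  refine lintegral_congr fun a => ?_
  have h1 : ∫⁻ e, g (a, d a + e) ∂ρ = ∫⁻ y, g (a, y) ∂(ρ.map (fun e => d a + e)) := by
    rw [lintegral_map (by fun_prop) (by fun_prop)]
  have hfa : Measurable fun y => f (a, y) := hf.comp measurable_prodMk_left
  rw [h1, h a, lintegral_withDensity_eq_lintegral_mul _ hfa (by fun_prop)]
  simp only [Pi.mul_apply]

lemma prod_noise_map_shear {ι A : Type*} [Fintype ι] [MeasurableSpace A] (μ : Measure A)
    [IsProbabilityMeasure μ] {v v' : ℝ≥0} (hv : v ≠ 0) (hv' : v' ≠ 0) {d : A → ι → ℝ}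
    (hd : Measurable d) :
    (μ.prod (noise ι v)).map (fun p => (p.1, d p.1 + p.2)) =
      (μ.prod (noise ι v')).withDensity
        (fun p => ∏ i, gaussianPDF (d p.1 i) v (p.2 i) / gaussianPDF 0 v' (p.2 i)) :=
  prod_map_shear_eq_withDensity μ _ _ hd (measurable_shear_density v v' hd) fun a => by
    rw [noise_map_const_add, pi_gaussianReal_eq_withDensity hv hv']

lemma log_gaussianPDFReal_div {v v' : ℝ≥0} (hv : v ≠ 0) (hv' : v' ≠ 0) (d e : ℝ) :
    Real.log (gaussianPDFReal d v (d + e) / gaussianPDFReal 0 v' (d + e)) =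
      1 / 2 * Real.log (v' / v) - e ^ 2 / (2 * v) + (d + e) ^ 2 / (2 * v') := by
  have h1 : (0 : ℝ) < v := by positivity
  have h2 : (0 : ℝ) < v' := by positivity
  have hpi := Real.pi_pos
  rw [Real.log_div (gaussianPDFReal_pos _ _ _ hv).ne' (gaussianPDFReal_pos _ _ _ hv').ne',
    gaussianPDFReal, gaussianPDFReal, Real.log_mul (by positivity) (Real.exp_ne_zero _),
    Real.log_mul (by positivity) (Real.exp_ne_zero _), Real.log_exp, Real.log_exp,
    Real.log_inv, Real.log_inv, Real.log_sqrt (by positivity), Real.log_sqrt (by positivity),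
    Real.log_mul (by positivity) h1.ne', Real.log_mul (by positivity) h2.ne',
    Real.log_div h2.ne' h1.ne']
  ring_nf

/-! ### Second moments and the divergence between Gaussian channels -/

lemma integrable_sq_gaussianReal (v : ℝ≥0) : Integrable (fun x => x ^ 2) (gaussianReal 0 v) :=
  (memLp_id_gaussianReal' 2 (by simp)).integrable_sq

lemma integral_sq_gaussianReal (v : ℝ≥0) : ∫ x, x ^ 2 ∂(gaussianReal 0 v) = v := by
  have h := variance_id_gaussianReal (μ := 0) (v := v)
  rw [variance_eq_integral (by fun_prop)] at h
  simpa using h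

lemma memLp_eval_noise {ι : Type*} [Fintype ι] (v : ℝ≥0) (i : ι) :
    MemLp (fun e : ι → ℝ => e i) 2 (noise ι v) :=
  (memLp_id_gaussianReal' 2 (by simp)).comp_measurePreserving
    (measurePreserving_eval (fun _ : ι => gaussianReal 0 v) i)

lemma integral_eval_noise {ι : Type*} [Fintype ι] (v : ℝ≥0) (i : ι) :
    ∫ e, e i ∂(noise ι v) = 0 := by
  have h := (measurePreserving_eval (fun _ : ι => gaussianReal 0 v) i)
  have h2 := integral_map (μ := noise ι v) (φ := Function.eval i) h.measurable.aemeasurable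
    (f := fun x : ℝ => x) (by fun_prop)
  rw [h.map_eq, integral_id_gaussianReal] at h2
  exact h2.symm

lemma integral_eval_sq_noise {ι : Type*} [Fintype ι] (v : ℝ≥0) (i : ι) :
    ∫ e, (e i) ^ 2 ∂(noise ι v) = v := by
  have h := (measurePreserving_eval (fun _ : ι => gaussianReal 0 v) i)
  have h2 := integral_map (μ := noise ι v) (φ := Function.eval i) h.measurable.aemeasurable
    (f := fun x : ℝ => x ^ 2) (by fun_prop)
  rw [h.map_eq, integral_sq_gaussianReal] at h2
  exact h2.symm

/-- Second moment of the sum of independent variables, the second of which is centred Gaussian. -/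
lemma integral_add_noise_sq {ι A : Type*} [Fintype ι] [MeasurableSpace A] (μ : Measure A)
    [IsProbabilityMeasure μ] (v : ℝ≥0) {d : A → ℝ} (hd : MemLp d 2 μ) (c : ℝ) (i : ι) :
    Integrable (fun p : A × (ι → ℝ) => (d p.1 + c * p.2 i) ^ 2) (μ.prod (noise ι v)) ∧
    ∫ p, (d p.1 + c * p.2 i) ^ 2 ∂(μ.prod (noise ι v)) = ∫ a, d a ^ 2 ∂μ + c ^ 2 * v := by
  have i1 : Integrable (fun p : A × (ι → ℝ) => d p.1 ^ 2) (μ.prod (noise ι v)) :=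
    hd.integrable_sq.comp_fst _
  have i2 : Integrable (fun p : A × (ι → ℝ) => (p.2 i) ^ 2) (μ.prod (noise ι v)) :=
    (memLp_eval_noise v i).integrable_sq.comp_snd μ
  have i3 : Integrable (fun p : A × (ι → ℝ) => d p.1 * p.2 i) (μ.prod (noise ι v)) :=
    (hd.integrable (by norm_num)).mul_prod ((memLp_eval_noise v i).integrable (by norm_num))
  have heq : (fun p : A × (ι → ℝ) => (d p.1 + c * p.2 i) ^ 2) =
      fun p => d p.1 ^ 2 + (2 * c * (d p.1 * p.2 i) + c ^ 2 * (p.2 i) ^ 2) := by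
    ext p; ring
  rw [heq]
  have i4 : Integrable (fun p : A × (ι → ℝ) => 2 * c * (d p.1 * p.2 i) + c ^ 2 * (p.2 i) ^ 2)
      (μ.prod (noise ι v)) := (i3.const_mul (2 * c)).add (i2.const_mul (c ^ 2))
  refine ⟨i1.add i4, ?_⟩
  have e1 : ∫ p, d p.1 ^ 2 ∂(μ.prod (noise ι v)) = ∫ a, d a ^ 2 ∂μ := by
    rw [integral_fun_fst (fun a => d a ^ 2)]; simp
  have e2 : ∫ p, (p.2 i) ^ 2 ∂(μ.prod (noise ι v)) = v := by
    rw [integral_fun_snd (fun e : ι → ℝ => (e i) ^ 2), integral_eval_sq_noise]; simp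
  have e3 : ∫ p, d p.1 * p.2 i ∂(μ.prod (noise ι v)) = 0 := by
    rw [integral_prod_mul d (fun e : ι → ℝ => e i), integral_eval_noise]; simp
  rw [integral_add i1 i4, integral_add (i3.const_mul _) (i2.const_mul _), integral_const_mul,
    integral_const_mul, e1, e2, e3]
  ring

/-- Kullback-Leibler divergence between two Gaussian channels of which the second has mean zero. -/
lemma klDiv_shear_noise {ι A : Type*} [Fintype ι] [MeasurableSpace A] (μ : Measure A)
    [IsProbabilityMeasure μ] {v v' : ℝ≥0} (hv : v ≠ 0) (hv' : v' ≠ 0) {d : A → ι → ℝ}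
    (hd : Measurable d) (hd2 : ∀ i, MemLp (fun a => d a i) 2 μ) :
    klDiv ((μ.prod (noise ι v)).map (fun p => (p.1, d p.1 + p.2))) (μ.prod (noise ι v')) =
      ENNReal.ofReal (∑ i, (1 / 2 * Real.log (v' / v) - 1 / 2
        + (∫ a, d a i ^ 2 ∂μ + v) / (2 * v'))) := by
  have hv0 : (v : ℝ) ≠ 0 := by positivity
  have hs : Measurable fun p : A × (ι → ℝ) => (p.1, d p.1 + p.2) := by fun_prop
  have hmeas := measurable_shear_density v v' hd
  have hP := prod_noise_map_shear μ hv hv' hd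
  set Pm := (μ.prod (noise ι v)).map (fun p => (p.1, d p.1 + p.2)) with hPm
  have : IsProbabilityMeasure Pm := Measure.isProbabilityMeasure_map hs.aemeasurable
  have hac : Pm ≪ μ.prod (noise ι v') := by
    rw [hP]; exact withDensity_absolutelyContinuous _ _
  have hllr : llr Pm (μ.prod (noise ι v')) =ᵐ[Pm] fun p =>
      ∑ i, Real.log (gaussianPDFReal (d p.1 i) v (p.2 i) / gaussianPDFReal 0 v' (p.2 i)) := by
    have h := Measure.rnDeriv_withDensity (μ.prod (noise ι v')) hmeas
    rw [← hP] at h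
    filter_upwards [hac.ae_eq h] with p hp
    rw [llr, hp, ENNReal.toReal_prod, Real.log_prod]
    · simp [ENNReal.toReal_div, toReal_gaussianPDF]
    · intro i _
      rw [ENNReal.toReal_div, toReal_gaussianPDF, toReal_gaussianPDF]
      exact (div_pos (gaussianPDFReal_pos _ _ _ hv) (gaussianPDFReal_pos _ _ _ hv')).ne'
  have hg : Measurable fun p : A × (ι → ℝ) =>
      ∑ i, Real.log (gaussianPDFReal (d p.1 i) v (p.2 i) / gaussianPDFReal 0 v' (p.2 i)) := by
    refine Finset.measurable_sum _ fun i _ => (Measurable.div ?_ ?_).log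
    · exact measurable_uncurry_gaussianPDFReal.comp
        (f := fun p : A × (ι → ℝ) => (d p.1 i, v, p.2 i)) (by fun_prop)
    · exact (measurable_gaussianPDFReal 0 v').comp (by fun_prop)
  -- Pulled back along the shear, the output minus its mean is the noise itself, so the
  -- log-likelihood ratio is a quadratic polynomial in mean and noise. Its integral therefore
  -- involves only second moments.
  have hcomp : ∀ p : A × (ι → ℝ), (∑ i, Real.log (gaussianPDFReal (d p.1 i) v ((d p.1 + p.2) i)
      / gaussianPDFReal 0 v' ((d p.1 + p.2) i))) =
      ∑ i, (1 / 2 * Real.log (v' / v) + (-(1 / (2 * v)) * (p.2 i) ^ 2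
        + 1 / (2 * v') * (d p.1 i + 1 * p.2 i) ^ 2)) := by
    intro p
    refine Finset.sum_congr rfl fun i _ => ?_
    rw [Pi.add_apply, log_gaussianPDFReal_div hv hv']
    ring
  have i1 : ∀ i, Integrable (fun p : A × (ι → ℝ) => -(1 / (2 * v : ℝ)) * (p.2 i) ^ 2)
      (μ.prod (noise ι v)) := fun i =>
    ((memLp_eval_noise v i).integrable_sq.comp_snd μ).const_mul _
  have i2 : ∀ i, Integrable (fun p : A × (ι → ℝ) => 1 / (2 * v' : ℝ) * (d p.1 i + 1 * p.2 i) ^ 2)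
      (μ.prod (noise ι v)) := fun i => (integral_add_noise_sq μ v (hd2 i) 1 i).1.const_mul _
  have i4 : ∀ i, Integrable (fun p : A × (ι → ℝ) => -(1 / (2 * v : ℝ)) * (p.2 i) ^ 2
        + 1 / (2 * v' : ℝ) * (d p.1 i + 1 * p.2 i) ^ 2) (μ.prod (noise ι v)) := fun i =>
    (i1 i).add (i2 i)
  have i3 : ∀ i ∈ (Finset.univ : Finset ι), Integrable (fun p : A × (ι → ℝ) =>
      1 / 2 * Real.log (v' / v) + (-(1 / (2 * v : ℝ)) * (p.2 i) ^ 2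
        + 1 / (2 * v' : ℝ) * (d p.1 i + 1 * p.2 i) ^ 2)) (μ.prod (noise ι v)) := fun i _ =>
    (integrable_const _).add (i4 i)
  have hint : Integrable (llr Pm (μ.prod (noise ι v'))) Pm := by
    rw [integrable_congr hllr, hPm, integrable_map_measure hg.aestronglyMeasurable hs.aemeasurable]
    refine (integrable_finsetSum _ i3).congr (ae_of_all _ fun p => ?_)
    exact (hcomp p).symm
  rw [klDiv_of_ac_of_integrable hac hint, integral_congr_ae hllr, hPm,
    integral_map hs.aemeasurable hg.aestronglyMeasurable]
  simp only [hcomp]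
  rw [integral_finsetSum _ i3, ← hPm]
  simp only [probReal_univ, add_sub_cancel_right]
  congr 1
  refine Finset.sum_congr rfl fun i _ => ?_
  rw [integral_add (integrable_const _) (i4 i), integral_add (i1 i) (i2 i),
    integral_const_mul (-(1 / (2 * v : ℝ))), integral_const_mul (1 / (2 * v' : ℝ)),
    (integral_add_noise_sq μ v (hd2 i) 1 i).2,
    integral_fun_snd (fun e : ι → ℝ => (e i) ^ 2), integral_eval_sq_noise]
  simp only [integral_const, probReal_univ, smul_eq_mul, one_mul]
  field_simp
  ring

/-! ### Data processing and chain rules for the divergence -/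

lemma klDiv_map_measurableEquiv {α β : Type*} [MeasurableSpace α] [MeasurableSpace β]
    (e : α ≃ᵐ β) (μ ν : Measure α) [IsFiniteMeasure μ] [IsFiniteMeasure ν] :
    klDiv (μ.map e) (ν.map e) = klDiv μ ν := by
  refine le_antisymm (klDiv_map_le _ _ e.measurable) ?_
  have h := klDiv_map_le (μ.map e) (ν.map e) e.symm.measurable
  rwa [MeasurableEquiv.map_symm_map, MeasurableEquiv.map_symm_map] at h

/-- The channel `a ↦ m a + E` with additive noise `E` of law `ρ`. -/
noncomputable def addNoise {A B : Type*} [MeasurableSpace A] [MeasurableSpace B] [Add B]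
    (m : A → B) (ρ : Measure B) : Kernel A B :=
  (Kernel.id ×ₖ Kernel.const A ρ).map (fun p => m p.1 + p.2)

lemma isMarkovKernel_addNoise {A B : Type*} [MeasurableSpace A] [MeasurableSpace B] [Add B]
    [MeasurableAdd₂ B] {m : A → B} (hm : Measurable m) (ρ : Measure B) [IsProbabilityMeasure ρ] :
    IsMarkovKernel (addNoise m ρ) :=
  Kernel.IsMarkovKernel.map _ (by fun_prop)

lemma compProd_addNoise {A B : Type*} [MeasurableSpace A] [MeasurableSpace B] [Add B]
    [MeasurableAdd₂ B] {m : A → B} (hm : Measurable m) (μ : Measure A) [SFinite μ]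
    (ρ : Measure B) [IsProbabilityMeasure ρ] :
    μ ⊗ₘ addNoise m ρ = (μ.prod ρ).map (fun p => (p.1, m p.1 + p.2)) := by
  have := isMarkovKernel_addNoise hm ρ
  refine Measure.ext_of_lintegral _ fun g hg => ?_
  rw [Measure.lintegral_compProd hg, lintegral_map hg (by fun_prop),
    lintegral_prod _ (by fun_prop)]
  refine lintegral_congr fun a => ?_
  rw [addNoise, Kernel.lintegral_map _ (by fun_prop) _ (by fun_prop),
    Kernel.lintegral_prod _ _ _ (by fun_prop)]
  simp only [Kernel.id_apply, Kernel.const_apply]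
  rw [lintegral_dirac']
  fun_prop

/-- Among all product references, the product of the marginals is the closest to a joint law. -/
lemma klDiv_prod_marginals_le {A B : Type*} [MeasurableSpace A] [StandardBorelSpace A]
    [Nonempty A] [MeasurableSpace B] (ρ : Measure (A × B)) [IsProbabilityMeasure ρ]
    (q : Measure B) [IsProbabilityMeasure q] :
    klDiv ρ (ρ.fst.prod ρ.snd) ≤ klDiv ρ (ρ.fst.prod q) := by
  have hsw : ∀ (r : Measure B) [IsProbabilityMeasure r],
      klDiv ρ (ρ.fst.prod r) = klDiv (ρ.snd ⊗ₘ (ρ.map Prod.swap).condKernel)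
        (r ⊗ₘ Kernel.const B ρ.fst) := by
    intro r _
    rw [← klDiv_map_measurableEquiv MeasurableEquiv.prodComm ρ, Measure.compProd_const]
    have h1 : Measure.map (MeasurableEquiv.prodComm) (ρ.fst.prod r) = r.prod ρ.fst :=
      Measure.prod_swap
    have h2 : ρ.snd ⊗ₘ (ρ.map Prod.swap).condKernel = ρ.map Prod.swap := by
      rw [← Measure.fst_map_swap, Measure.disintegrate]
    rw [h1, h2]
    rfl
  -- With the second coordinate drawn first, the chain rule reads `D(ρ ‖ ρ_A × q) = D(ρ_B ‖ q) + D(ρ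
  -- ‖ ρ_A × ρ_B)`; the extra term is nonnegative.
  rw [hsw, hsw q, klDiv_compProd_eq_add _ q]
  exact le_add_self

/-- Information of the first variable about one output is at most that about another output, plus
the divergence of the first output from a backward channel out of the second. -/
lemma klDiv_prod_le_add {Ω 𝓢 𝓣 B : Type*} [MeasurableSpace Ω] [MeasurableSpace 𝓢]
    [StandardBorelSpace 𝓢] [Nonempty 𝓢] [MeasurableSpace 𝓣] [MeasurableSpace B]
    [StandardBorelSpace B] [Nonempty B] [Add B] [MeasurableAdd₂ B]
    (P : Measure Ω) [IsProbabilityMeasure P] {T : Ω → 𝓣} (hT : Measurable T) {f : 𝓣 → 𝓢}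
    (hf : Measurable f) {Y Z : Ω → B} (hY : Measurable Y) (hZ : Measurable Z) {m : B → B}
    (hm : Measurable m) (ρ : Measure B) [IsProbabilityMeasure ρ] :
    klDiv (P.map fun ω => (f (T ω), Y ω)) ((P.map fun ω => f (T ω)).prod (P.map Y)) ≤
      klDiv (P.map fun ω => (f (T ω), Z ω)) ((P.map fun ω => f (T ω)).prod (P.map Z)) +
      klDiv (P.map fun ω => ((T ω, Z ω), Y ω))
        (((P.map fun ω => (T ω, Z ω)).prod ρ).map fun p => (p.1, m p.1.2 + p.2)) := by
  have hfT : Measurable fun ω => f (T ω) := hf.comp hT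
  have := Measure.isProbabilityMeasure_map (μ := P) hfT.aemeasurable
  have := Measure.isProbabilityMeasure_map (μ := P) hY.aemeasurable
  have := Measure.isProbabilityMeasure_map (μ := P) hZ.aemeasurable
  have : IsProbabilityMeasure (P.map fun ω => (T ω, Z ω)) :=
    Measure.isProbabilityMeasure_map (by fun_prop)
  have : IsProbabilityMeasure (P.map fun ω => (f (T ω), Z ω)) :=
    Measure.isProbabilityMeasure_map (by fun_prop)
  have : IsProbabilityMeasure (P.map fun ω => (f (T ω), (Z ω, Y ω))) :=
    Measure.isProbabilityMeasure_map (by fun_prop)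
  have : IsProbabilityMeasure (P.map fun ω => ((f (T ω), Z ω), Y ω)) :=
    Measure.isProbabilityMeasure_map (by fun_prop)
  have : IsProbabilityMeasure (P.map fun ω => ((T ω, Z ω), Y ω)) :=
    Measure.isProbabilityMeasure_map (by fun_prop)
  have : IsProbabilityMeasure (P.map fun ω => (Z ω, Y ω)) :=
    Measure.isProbabilityMeasure_map (by fun_prop)
  have hfst : (P.map fun ω => (f (T ω), (Z ω, Y ω))).fst = P.map fun ω => f (T ω) :=
    Measure.fst_map_prodMk (by fun_prop)
  have hsnd : (P.map fun ω => (f (T ω), (Z ω, Y ω))).snd = P.map fun ω => (Z ω, Y ω) :=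
    Measure.snd_map_prodMk (by fun_prop)
  set q : Measure (B × B) := ((P.map Z).prod ρ).map fun p => (p.1, m p.1 + p.2) with hq
  have : IsProbabilityMeasure q := Measure.isProbabilityMeasure_map (by fun_prop)
  have : IsProbabilityMeasure (((P.map fun ω => (T ω, Z ω)).prod ρ).map
      fun p => (p.1, m p.1.2 + p.2)) := Measure.isProbabilityMeasure_map (by fun_prop)
  -- With `S = f(T)`, `R` the channel `z ↦ m z + E` and `q = P_Z ⊗ R`, the chain is `I(S;Y) ≤
  -- I(S;(Z,Y)) ≤ D(P_{SZY} ‖ P_S × q) = I(S;Z) + D(P_{SZY} ‖ P_{SZ} ⊗ R)`. Data processing then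
  -- replaces `S` by the finer variable `T` in the last divergence.
  calc klDiv (P.map fun ω => (f (T ω), Y ω)) ((P.map fun ω => f (T ω)).prod (P.map Y))
      ≤ klDiv (P.map fun ω => (f (T ω), (Z ω, Y ω)))
          ((P.map fun ω => f (T ω)).prod (P.map fun ω => (Z ω, Y ω))) := by
        have h := klDiv_map_le (P.map fun ω => (f (T ω), (Z ω, Y ω)))
          ((P.map fun ω => f (T ω)).prod (P.map fun ω => (Z ω, Y ω)))
          (g := Prod.map id Prod.snd) (by fun_prop)
        rw [Measure.map_map (by fun_prop) (by fun_prop),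
          ← Measure.map_prod_map _ _ measurable_id measurable_snd, Measure.map_id,
          Measure.map_map (by fun_prop) (by fun_prop)] at h
        exact h
    _ ≤ klDiv (P.map fun ω => (f (T ω), (Z ω, Y ω))) ((P.map fun ω => f (T ω)).prod q) := by
        have h := klDiv_prod_marginals_le (P.map fun ω => (f (T ω), (Z ω, Y ω))) q
        rwa [hfst, hsnd] at h
    _ = klDiv (P.map fun ω => ((f (T ω), Z ω), Y ω))
          (((P.map fun ω => f (T ω)).prod (P.map Z)) ⊗ₘ
            addNoise (fun p : 𝓢 × B => m p.2) ρ) := by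
        rw [← klDiv_map_measurableEquiv MeasurableEquiv.prodAssoc.symm,
          Measure.map_map (by fun_prop) (by fun_prop), compProd_addNoise (by fun_prop)]
        congr 1
        have h := Measure.map_prod_map (P.map fun ω => f (T ω)) ((P.map Z).prod ρ)
          (f := id) (g := fun p => (p.1, m p.1 + p.2)) measurable_id (by fun_prop)
        rw [Measure.map_id] at h
        rw [hq, h, ← Measure.prodAssoc_prod, Measure.map_map (by fun_prop) (by fun_prop),
          Measure.map_map (by fun_prop) (by fun_prop)]
        rfl
    _ = klDiv (P.map fun ω => (f (T ω), Z ω)) ((P.map fun ω => f (T ω)).prod (P.map Z)) +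
          klDiv (P.map fun ω => ((f (T ω), Z ω), Y ω))
            ((P.map fun ω => (f (T ω), Z ω)) ⊗ₘ addNoise (fun p : 𝓢 × B => m p.2) ρ) := by
        have := isMarkovKernel_addNoise (m := fun p : 𝓢 × B => m p.2) (by fun_prop) ρ
        have hd : P.map (fun ω => ((f (T ω), Z ω), Y ω)) = (P.map fun ω => (f (T ω), Z ω)) ⊗ₘ
            (P.map fun ω => ((f (T ω), Z ω), Y ω)).condKernel := by
          conv_lhs => rw [← Measure.disintegrate (P.map fun ω => ((f (T ω), Z ω), Y ω))
            (P.map fun ω => ((f (T ω), Z ω), Y ω)).condKernel]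
          rw [Measure.fst_map_prodMk (by fun_prop)]
        rw [hd, klDiv_compProd_eq_add]
    _ ≤ _ := by
        gcongr
        have h := klDiv_map_le (P.map fun ω => ((T ω, Z ω), Y ω))
          (((P.map fun ω => (T ω, Z ω)).prod ρ).map fun p => (p.1, m p.1.2 + p.2))
          (g := fun p => ((f p.1.1, p.1.2), p.2)) (by fun_prop)
        rw [Measure.map_map (by fun_prop) (by fun_prop),
          Measure.map_map (by fun_prop) (by fun_prop)] at h
        refine le_trans (le_of_eq ?_) h
        rw [compProd_addNoise (by fun_prop)]
        congr 1
        have h2 := Measure.map_prod_map (P.map fun ω => (T ω, Z ω)) ρ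
          (f := fun p => (f p.1, p.2)) (g := id) (by fun_prop) measurable_id
        rw [Measure.map_id, Measure.map_map (by fun_prop) (by fun_prop)] at h2
        have h3 : ((fun p : 𝓣 × B => (f p.1, p.2)) ∘ fun ω => (T ω, Z ω)) =
          fun ω => (f (T ω), Z ω) := rfl
        rw [h3] at h2
        rw [h2, Measure.map_map (by fun_prop) (by fun_prop)]
        rfl

/-- Conditional independence as sequential sampling: once `C` is drawn, the `B`-coordinate can be
drawn first, and the `𝓣`-coordinate then ignores it. The next lemma is the same with the roles of
the two coordinates exchanged. -/
lemma map_compProd_prod {C 𝓣 B : Type*} [MeasurableSpace C] [MeasurableSpace 𝓣]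
    [MeasurableSpace B] (μ : Measure C) [SFinite μ] (κ : Kernel C 𝓣) [IsMarkovKernel κ]
    (η : Kernel C B) [IsMarkovKernel η] :
    (μ ⊗ₘ (κ ×ₖ η)).map (fun p => ((p.1, p.2.2), p.2.1)) =
      (μ ⊗ₘ η) ⊗ₘ (κ.prodMkRight B) := by
  refine Measure.ext_of_lintegral _ fun g hg => ?_
  rw [lintegral_map hg (by fun_prop), Measure.lintegral_compProd (by fun_prop),
    Measure.lintegral_compProd hg,
    Measure.lintegral_compProd (Measurable.lintegral_kernel_prod_right' hg)]
  refine lintegral_congr fun c => ?_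
  rw [Kernel.lintegral_prod _ _ _ (by fun_prop), lintegral_lintegral_swap (by fun_prop)]
  rfl

lemma map_compProd_prod' {C 𝓣 B : Type*} [MeasurableSpace C] [MeasurableSpace 𝓣]
    [MeasurableSpace B] (μ : Measure C) [SFinite μ] (κ : Kernel C 𝓣) [IsMarkovKernel κ]
    (η : Kernel C B) [IsMarkovKernel η] :
    (μ ⊗ₘ (κ ×ₖ η)).map (fun p => ((p.2.1, p.1), p.2.2)) =
      ((μ ⊗ₘ κ).map Prod.swap) ⊗ₘ (η.prodMkLeft 𝓣) := by
  refine Measure.ext_of_lintegral _ fun g hg => ?_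
  have hm : Measurable fun p : C × 𝓣 => ∫⁻ b, g (p.swap, b) ∂((η.prodMkLeft 𝓣) p.swap) :=
    (Measurable.lintegral_kernel_prod_right' (κ := η.prodMkLeft 𝓣) hg).comp measurable_swap
  rw [lintegral_map hg (by fun_prop), Measure.lintegral_compProd (by fun_prop),
    Measure.lintegral_compProd hg, lintegral_map (Measurable.lintegral_kernel_prod_right' hg)
      measurable_swap, Measure.lintegral_compProd hm]
  refine lintegral_congr fun c => ?_
  rw [Kernel.lintegral_prod _ _ _ (by fun_prop)]
  rfl

/-- The divergence from any backward channel splits into the conditional mutual information and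
the divergence of the output pair from that channel. -/
lemma klDiv_condDistrib_add {Ω 𝓣 B C : Type*} [MeasurableSpace Ω]
    [MeasurableSpace 𝓣] [StandardBorelSpace 𝓣] [Nonempty 𝓣] [MeasurableSpace B]
    [StandardBorelSpace B] [Nonempty B] [MeasurableSpace C]
    (P : Measure Ω) [IsProbabilityMeasure P] {T : Ω → 𝓣} (hT : Measurable T)
    {Y : Ω → B} {Z : Ω → C} (hY : Measurable Y) (hZ : Measurable Z)
    (R : Kernel C B) [IsMarkovKernel R] :
    klDiv (P.map fun ω => ((T ω, Z ω), Y ω))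
        ((P.map fun ω => (T ω, Z ω)) ⊗ₘ (R.prodMkLeft 𝓣)) =
      klDiv (P.map fun ω => (Z ω, Y ω)) ((P.map Z) ⊗ₘ R) +
      klDiv (P.map fun ω => (Z ω, (T ω, Y ω)))
        ((P.map Z) ⊗ₘ (condDistrib T Z P ×ₖ condDistrib Y Z P)) := by
  have : IsProbabilityMeasure (P.map Z) := Measure.isProbabilityMeasure_map hZ.aemeasurable
  have : IsProbabilityMeasure (P.map fun ω => (T ω, Z ω)) :=
    Measure.isProbabilityMeasure_map (by fun_prop)
  have : IsProbabilityMeasure (P.map fun ω => (Z ω, Y ω)) :=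
    Measure.isProbabilityMeasure_map (by fun_prop)
  have : IsProbabilityMeasure (P.map fun ω => (Z ω, (T ω, Y ω))) :=
    Measure.isProbabilityMeasure_map (by fun_prop)
  let e : C × 𝓣 × B ≃ᵐ (C × B) × 𝓣 :=
    ((MeasurableEquiv.refl C).prodCongr MeasurableEquiv.prodComm).trans
      MeasurableEquiv.prodAssoc.symm
  have he : (e : C × 𝓣 × B → (C × B) × 𝓣) = fun p => ((p.1, p.2.2), p.2.1) := rfl
  let e' : C × 𝓣 × B ≃ᵐ (𝓣 × C) × B :=
    MeasurableEquiv.prodAssoc.symm.trans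
      (MeasurableEquiv.prodComm.prodCongr (MeasurableEquiv.refl B))
  have he' : (e' : C × 𝓣 × B → (𝓣 × C) × B) = fun p => ((p.2.1, p.1), p.2.2) := rfl
  have hZY : (P.map Z) ⊗ₘ condDistrib Y Z P = P.map fun ω => (Z ω, Y ω) :=
    compProd_map_condDistrib hY.aemeasurable
  have hZT : (P.map Z) ⊗ₘ condDistrib T Z P = P.map fun ω => (Z ω, T ω) :=
    compProd_map_condDistrib hT.aemeasurable
  have hTZY : P.map (fun ω => ((Z ω, Y ω), T ω)) =
      (P.map fun ω => (Z ω, Y ω)) ⊗ₘ condDistrib T (fun ω => (Z ω, Y ω)) P :=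
    (compProd_map_condDistrib hT.aemeasurable).symm
  have h1 : klDiv (P.map fun ω => (Z ω, (T ω, Y ω)))
        ((P.map Z) ⊗ₘ (condDistrib T Z P ×ₖ condDistrib Y Z P)) =
      klDiv (P.map fun ω => ((Z ω, Y ω), T ω))
        ((P.map fun ω => (Z ω, Y ω)) ⊗ₘ (condDistrib T Z P).prodMkRight B) := by
    rw [← klDiv_map_measurableEquiv e, he, map_compProd_prod, hZY,
      Measure.map_map (by fun_prop) (by fun_prop)]
    rfl
  have h2 : klDiv (P.map fun ω => ((T ω, Z ω), Y ω))
        ((P.map fun ω => (T ω, Z ω)) ⊗ₘ (R.prodMkLeft 𝓣)) =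
      klDiv (P.map fun ω => ((Z ω, Y ω), T ω))
        (((P.map Z) ⊗ₘ R) ⊗ₘ (condDistrib T Z P).prodMkRight B) := by
    have h3 : P.map (fun ω => (T ω, Z ω)) =
        ((P.map Z) ⊗ₘ condDistrib T Z P).map Prod.swap := by
      rw [hZT, Measure.map_map (by fun_prop) (by fun_prop)]
      rfl
    have h4 : P.map (fun ω => ((T ω, Z ω), Y ω)) =
        (P.map fun ω => (Z ω, (T ω, Y ω))).map e' := by
      rw [Measure.map_map e'.measurable (by fun_prop)]
      rfl
    rw [h3, ← map_compProd_prod', ← he', h4, klDiv_map_measurableEquiv,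
      ← klDiv_map_measurableEquiv e, he, map_compProd_prod,
      Measure.map_map (by fun_prop) (by fun_prop)]
    rfl
  -- With `T` drawn last, both reference laws end in the same kernel `P_{T|Z}` and differ only in
  -- the law of `(Z, Y)`. The chain rule therefore isolates `D(P_{ZY} ‖ P_Z ⊗ R)` and leaves the
  -- conditional mutual information.
  rw [h1, h2, hTZY, klDiv_compProd_eq_add]

/-! ### Forward and backward representations of degraded Gaussian noise -/

lemma gaussianReal_prod_map_linear (α β : ℝ) {u v r : ℝ≥0}
    (h : (r : ℝ) = α ^ 2 * u + β ^ 2 * v) :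
    ((gaussianReal 0 u).prod (gaussianReal 0 v)).map (fun p => α * p.1 + β * p.2) =
      gaussianReal 0 r := by
  have h1 := Measure.map_prod_map (gaussianReal 0 u) (gaussianReal 0 v)
    (f := fun x => α * x) (g := fun x => β * x) (by fun_prop) (by fun_prop)
  have h2 : (fun p : ℝ × ℝ => α * p.1 + β * p.2) =
    (fun p => p.1 + p.2) ∘ Prod.map (fun x => α * x) (fun x => β * x) := rfl
  rw [h2, ← Measure.map_map (by fun_prop) (by fun_prop), ← h1, gaussianReal_map_const_mul,
    gaussianReal_map_const_mul]
  change Measure.conv (gaussianReal _ _) (gaussianReal _ _) = _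
  rw [gaussianReal_conv_gaussianReal]
  congr 1
  · ring
  · ext; simpa using h.symm

/-- The Cramér-Wold device in the plane: the characteristic function of a law at a linear form is
that of its one-dimensional image at `1`. -/
lemma map_linear_pair_eq {ρ ρ' : Measure (ℝ × ℝ)} [IsFiniteMeasure ρ] [IsFiniteMeasure ρ']
    (h : ∀ α β : ℝ, ρ.map (fun p => α * p.1 + β * p.2) = ρ'.map (fun p => α * p.1 + β * p.2)) :
    ρ = ρ' := by
  refine Measure.ext_of_charFunDual ?_
  ext L
  have hL : (L : ℝ × ℝ → ℝ) = fun p => L (1, 0) * p.1 + L (0, 1) * p.2 := by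
    ext p
    have : p = p.1 • ((1, 0) : ℝ × ℝ) + p.2 • ((0, 1) : ℝ × ℝ) := by ext <;> simp
    conv_lhs => rw [this, map_add, map_smul, map_smul]
    simp [mul_comm]
  rw [charFunDual_eq_charFun_map_one, charFunDual_eq_charFun_map_one, hL, h]

/-- The forward Gaussian noises `(N, N + N')` and their backward representation. -/
lemma gaussianReal_degraded_eq {s t v δ : ℝ≥0} {a : ℝ} (hδ : (t : ℝ) = s + δ)
    (ha : a * t = s) (hv : (s : ℝ) = a ^ 2 * t + v) :
    ((gaussianReal 0 s).prod (gaussianReal 0 δ)).map (fun p => (p.1, p.1 + p.2)) =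
      ((gaussianReal 0 t).prod (gaussianReal 0 v)).map (fun p => (a * p.1 + p.2, p.1)) := by
  have := Measure.isProbabilityMeasure_map (μ := (gaussianReal 0 s).prod (gaussianReal 0 δ))
    (f := fun p => (p.1, p.1 + p.2)) (by fun_prop)
  have := Measure.isProbabilityMeasure_map (μ := (gaussianReal 0 t).prod (gaussianReal 0 v))
    (f := fun p => (a * p.1 + p.2, p.1)) (by fun_prop)
  refine map_linear_pair_eq fun α β => ?_
  rw [Measure.map_map (by fun_prop) (by fun_prop), Measure.map_map (by fun_prop) (by fun_prop)]
  have e1 : ((fun p : ℝ × ℝ => α * p.1 + β * p.2) ∘ fun p : ℝ × ℝ => (p.1, p.1 + p.2)) =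
      fun p => (α + β) * p.1 + β * p.2 := by ext p; simp; ring
  have e2 : ((fun p : ℝ × ℝ => α * p.1 + β * p.2) ∘ fun p : ℝ × ℝ => (a * p.1 + p.2, p.1)) =
      fun p => (α * a + β) * p.1 + α * p.2 := by ext p; simp; ring
  -- This is the variance of `α N + β (N + N')`. On the backward side the same variance results
  -- because `a * t = s` matches the covariance and the hypothesis on `v` matches the variance of
  -- the first coordinate.
  set r : ℝ≥0 := ⟨(α + β) ^ 2 * s + β ^ 2 * δ, by positivity⟩ with hr
  rw [e1, e2, gaussianReal_prod_map_linear (r := r) _ _ rfl,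
    gaussianReal_prod_map_linear (r := r)]
  change (α + β) ^ 2 * (s : ℝ) + β ^ 2 * δ = _
  have hv' : (v : ℝ) = s - a ^ 2 * t := by linarith
  have hδ' : (δ : ℝ) = t - s := by linarith
  rw [hv', hδ', ← ha]
  ring

lemma pi_prod_pi_map {ι : Type*} [Fintype ι] (ρ₁ ρ₂ : Measure ℝ) [IsProbabilityMeasure ρ₁]
    [IsProbabilityMeasure ρ₂] {g : ℝ × ℝ → ℝ} (hg : Measurable g) :
    ((Measure.pi fun _ : ι => ρ₁).prod (Measure.pi fun _ : ι => ρ₂)).map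
      (fun p i => g (p.1 i, p.2 i)) = Measure.pi fun _ : ι => (ρ₁.prod ρ₂).map g := by
  have h := (measurePreserving_arrowProdEquivProdArrow ℝ ℝ ι (fun _ => ρ₁) (fun _ => ρ₂)).map_eq
  have : IsProbabilityMeasure ((ρ₁.prod ρ₂).map g) :=
    Measure.isProbabilityMeasure_map hg.aemeasurable
  have h2 := Measure.pi_map_pi (μ := fun _ : ι => ρ₁.prod ρ₂) (f := fun _ => g)
    (fun i => hg.aemeasurable)
  rw [← h2, ← h, Measure.map_map (by fun_prop) (by fun_prop)]
  rfl

lemma noise_prod_noise_map {ι : Type*} [Fintype ι] {t v s : ℝ≥0} {a : ℝ}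
    (hv : (s : ℝ) = a ^ 2 * t + v) :
    ((noise ι t).prod (noise ι v)).map (fun p => a • p.1 + p.2) = noise ι s := by
  have h := pi_prod_pi_map (ι := ι) (gaussianReal 0 t) (gaussianReal 0 v)
    (g := fun p => a * p.1 + p.2) (by fun_prop)
  have h2 := gaussianReal_prod_map_linear a 1 (u := t) (v := v) (r := s) (by simpa using hv)
  simp only [one_mul] at h2
  rw [h2] at h
  exact h

/-! ### The Gaussian backward channel -/

/-- Slope of the linear estimate of `W + N` from `W + N + N'`, for variances `Q`, `s`, `t` of `W`,
`N`, `N + N'`. -/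
noncomputable def bwdSlope (Q : ℝ) (s t : ℝ≥0) : ℝ := (Q + s) / (Q + t)

/-- Error variance of the linear estimate of `W + N` from `W + N + N'`. -/
noncomputable def bwdVar (Q : ℝ) (s t : ℝ≥0) : ℝ≥0 := ((Q + s) * (t - s) / (Q + t)).toNNReal

section
variable {Q : ℝ} {s t : ℝ≥0}

lemma coe_bwdVar (hQ : 0 ≤ Q) (hst : s ≤ t) :
    (bwdVar Q s t : ℝ) = (Q + s) * (t - s) / (Q + t) := by
  have : (s : ℝ) ≤ t := by exact_mod_cast hst
  exact Real.coe_toNNReal _ (div_nonneg (mul_nonneg (by positivity) (by linarith)) (by positivity))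

/-- The case of zero signal power: the weaker noise splits into its regression on the stronger one
and an independent error. This supplies the backward coupling. -/
lemma bwdVar_decomposition (hs : 0 < s) (hst : s ≤ t) :
    (s : ℝ) = bwdSlope 0 s t ^ 2 * t + bwdVar 0 s t := by
  have h : (s : ℝ) ≤ t := by exact_mod_cast hst
  have h' : (0 : ℝ) < s := by exact_mod_cast hs
  have : (0 : ℝ) < t := by linarith
  rw [coe_bwdVar le_rfl hst, bwdSlope]
  field_simp
  ring

/-- In the backward coupling, `Y - b Z = (1 - b) W + (a - b) N_z + E` with independent terms, where
`a` and `b` are the slopes for powers `0` and `Q`. The left side is the variance of this error when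
`W` has power `Q`. -/
lemma bwdVar_eq_mse (hQ : 0 ≤ Q) (hs : 0 < s) (hst : s ≤ t) :
    (1 - bwdSlope Q s t) ^ 2 * Q + (bwdSlope 0 s t - bwdSlope Q s t) ^ 2 * t + bwdVar 0 s t =
      bwdVar Q s t := by
  have h : (s : ℝ) ≤ t := by exact_mod_cast hst
  have h' : (0 : ℝ) < s := by exact_mod_cast hs
  have : (0 : ℝ) < t := by linarith
  rw [coe_bwdVar le_rfl hst, coe_bwdVar hQ hst, bwdSlope, bwdSlope]
  field_simp
  ring

lemma bwdVar_div (hQ : 0 ≤ Q) (hs : 0 < s) (hst : s < t) :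
    (bwdVar Q s t : ℝ) / bwdVar 0 s t = (1 + Q / s) / (1 + Q / t) := by
  have h : (s : ℝ) < t := by exact_mod_cast hst
  have h' : (0 : ℝ) < s := by exact_mod_cast hs
  have h3 : (0 : ℝ) < t := by linarith
  have h4 : (t : ℝ) - s ≠ 0 := by linarith
  rw [coe_bwdVar le_rfl hst.le, coe_bwdVar hQ hst.le]
  field_simp
  ring

/-- Divergence between the true backward channel and the Gaussian one of signal power `Q`. -/
noncomputable def bwdDiv (Q : ℝ) (s t : ℝ≥0) (n : ℕ) (p : ℝ) : ℝ≥0∞ :=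
  ENNReal.ofReal (n * (1 / 2 * Real.log ((1 + Q / s) / (1 + Q / t))) +
    (1 - bwdSlope Q s t) ^ 2 / (2 * bwdVar Q s t) * (p - n * Q))

/-- Given the source and `Z`, both channels to `Y` are Gaussian, with fixed variances and means
depending linearly on `W` and `N_z`. The result thus depends on `w` only through its total second
moment, and no Gaussianity of `w` is needed. -/
lemma klDiv_backward {ι A : Type*} [Fintype ι] [MeasurableSpace A] (μ : Measure A)
    [IsProbabilityMeasure μ] (hQ : 0 ≤ Q) (hs : 0 < s) (hst : s ≤ t) {w : A → ι → ℝ}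
    (hw : Measurable w) (hw2 : ∀ i, MemLp (fun a => w a i) 2 μ)
    {P : Measure ((A × (ι → ℝ)) × (ι → ℝ))}
    (hP : P = (μ.prod (noise ι t)).prod (noise ι (bwdVar 0 s t))) :
    klDiv (P.map fun ω => ((ω.1.1, w ω.1.1 + ω.1.2),
        w ω.1.1 + (bwdSlope 0 s t • ω.1.2 + ω.2)))
      (((P.map fun ω => (ω.1.1, w ω.1.1 + ω.1.2)).prod (noise ι (bwdVar Q s t))).map
        fun p => (p.1, bwdSlope Q s t • p.1.2 + p.2)) =
      bwdDiv Q s t (Fintype.card ι) (∑ i, ∫ a, w a i ^ 2 ∂μ) := by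
  set a := bwdSlope 0 s t with ha
  set b := bwdSlope Q s t with hb
  set v := bwdVar 0 s t with hv
  set v' := bwdVar Q s t with hv'
  set g : A × (ι → ℝ) → A × (ι → ℝ) := fun p => (p.1, w p.1 + p.2) with hg
  have hgm : Measurable g := by fun_prop
  set L := (μ.prod (noise ι t)).map g with hL
  have : IsProbabilityMeasure L := Measure.isProbabilityMeasure_map hgm.aemeasurable
  have hPL : P.map (fun ω => (ω.1.1, w ω.1.1 + ω.1.2)) = L := by
    have : (fun ω : (A × (ι → ℝ)) × (ι → ℝ) => (ω.1.1, w ω.1.1 + ω.1.2)) = g ∘ Prod.fst := rfl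
    rw [this, ← Measure.map_map hgm measurable_fst, hP, Measure.map_fst_prod]
    simp [hL]
  have hPL2 : P.map (fun ω => ((ω.1.1, w ω.1.1 + ω.1.2), w ω.1.1 + (a • ω.1.2 + ω.2))) =
      (L.prod (noise ι v)).map
        (fun p => (p.1, (w p.1.1 + a • (p.1.2 - w p.1.1)) + p.2)) := by
    have h := Measure.map_prod_map (μ.prod (noise ι t)) (noise ι v) hgm measurable_id
    rw [Measure.map_id] at h
    rw [hL, h, Measure.map_map (by fun_prop) (by fun_prop), hP]
    congr 1
    ext ω : 1
    simp [hg, add_assoc]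
  rw [hPL, hPL2, bwdDiv, ← hb, ← hv']
  -- For equal variances both channels copy `Z`: the slopes are `1` and the error variances `0`.
  -- Since `1 - b = 0`, the division by zero in `bwdDiv` does no harm and both sides vanish.
  rcases hst.eq_or_lt with rfl | hlt
  · have hs' : (s : ℝ) ≠ 0 := by positivity
    have hQs : Q + s ≠ 0 := by positivity
    have hv0 : v = 0 := by simp [hv, bwdVar]
    have hv'0 : v' = 0 := by simp [hv', bwdVar]
    have ha1 : a = 1 := by simp [ha, bwdSlope, hs']
    have hb1 : b = 1 := by simp [hb, bwdSlope, hQs]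
    have hQs' : 1 + Q / s ≠ 0 := by positivity
    have : IsProbabilityMeasure ((L.prod (noise ι 0)).map fun p => (p.1, p.1.2 + p.2)) :=
      Measure.isProbabilityMeasure_map (by fun_prop)
    rw [hv0, hv'0, ha1, hb1]
    simp [hQs', klDiv_self]
  have hQt : (0 : ℝ) < Q + t := by
    have : (0 : ℝ) < t := by exact_mod_cast hs.trans hlt
    linarith
  have hts : (0 : ℝ) < t - s := by
    have : (s : ℝ) < t := by exact_mod_cast hlt
    linarith
  have hs' : (0 : ℝ) < s := by exact_mod_cast hs
  have hvr : (0 : ℝ) < v := by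
    rw [hv, coe_bwdVar le_rfl hst, zero_add, zero_add]
    exact div_pos (mul_pos hs' hts) (by linarith)
  have hvr' : (0 : ℝ) < v' := by
    rw [hv', coe_bwdVar hQ hst]
    exact div_pos (mul_pos (by linarith) hts) hQt
  have hv0 : v ≠ 0 := by rintro h; simp [h] at hvr
  have hv'0 : v' ≠ 0 := by rintro h; simp [h] at hvr'
  -- Subtracting the reference mean `b Z` from the output is a measurable bijection, which makes the
  -- reference centred and leaves the true conditional mean `d`. In terms of signal and noise, `d`
  -- is `(1 - b) W + (a - b) N_z`.
  set d : A × (ι → ℝ) → ι → ℝ := fun p => (w p.1 + a • (p.2 - w p.1)) - b • p.2 with hd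
  have hdm : Measurable d := by fun_prop
  have hdg : ∀ p i, d (g p) i = (1 - b) * w p.1 i + (a - b) * p.2 i := by
    intro p i
    simp only [hd, hg, Pi.sub_apply, Pi.add_apply, Pi.smul_apply, smul_eq_mul]
    ring
  have hsq : ∀ i, Integrable (fun p => d p i ^ 2) L ∧
      ∫ p, d p i ^ 2 ∂L = (1 - b) ^ 2 * ∫ a, w a i ^ 2 ∂μ + (a - b) ^ 2 * t := by
    intro i
    have h := integral_add_noise_sq μ t ((hw2 i).const_mul (1 - b)) (a - b) i
    have hm : AEStronglyMeasurable (fun p => d p i ^ 2) L :=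
      Measurable.aestronglyMeasurable (by fun_prop)
    constructor
    · rw [hL, integrable_map_measure hm hgm.aemeasurable]
      refine h.1.congr (ae_of_all _ fun p => ?_)
      simp only [Function.comp_apply, hdg]
    · rw [hL, integral_map hgm.aemeasurable hm]
      simp only [hdg]
      rw [h.2]
      simp only [mul_pow, integral_const_mul]
  have hd2 : ∀ i, MemLp (fun p => d p i) 2 L := fun i =>
    (memLp_two_iff_integrable_sq (Measurable.aestronglyMeasurable (by fun_prop))).2 (hsq i).1
  have hkl := klDiv_shear_noise L hv0 hv'0 hdm hd2
  have : IsProbabilityMeasure ((L.prod (noise ι v)).map (fun p => (p.1, d p.1 + p.2))) :=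
    Measure.isProbabilityMeasure_map (by fun_prop)
  let e : (A × (ι → ℝ)) × (ι → ℝ) ≃ᵐ (A × (ι → ℝ)) × (ι → ℝ) :=
    { toFun := fun p => (p.1, b • p.1.2 + p.2)
      invFun := fun p => (p.1, -(b • p.1.2) + p.2)
      left_inv := fun p => by simp
      right_inv := fun p => by simp
      measurable_toFun := by simp only [Equiv.coe_fn_mk]; fun_prop
      measurable_invFun := by simp only [Equiv.coe_fn_symm_mk]; fun_prop }
  have he : (e : (A × (ι → ℝ)) × (ι → ℝ) → _) = fun p => (p.1, b • p.1.2 + p.2) := rfl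
  rw [← klDiv_map_measurableEquiv e, he, Measure.map_map (by fun_prop) (by fun_prop)] at hkl
  have hcomp : ((fun p : (A × (ι → ℝ)) × (ι → ℝ) => (p.1, b • p.1.2 + p.2)) ∘
      fun p : (A × (ι → ℝ)) × (ι → ℝ) => (p.1, d p.1 + p.2)) =
      fun p => (p.1, (w p.1.1 + a • (p.1.2 - w p.1.1)) + p.2) := by
    ext p : 1
    simp only [Function.comp_apply, hd, Prod.mk.injEq, true_and]
    abel
  rw [hcomp] at hkl
  rw [hkl]
  congr 1
  have hmse := bwdVar_eq_mse hQ hs hst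
  rw [← ha, ← hb, ← hv, ← hv'] at hmse
  have hdiv := bwdVar_div hQ hs hlt
  rw [← hv, ← hv'] at hdiv
  have hterm : ∀ i, (1 / 2 * Real.log (v' / v) - 1 / 2 + (∫ p, d p i ^ 2 ∂L + v) / (2 * v')) =
      1 / 2 * Real.log ((1 + Q / s) / (1 + Q / t))
        + (1 - b) ^ 2 / (2 * v') * (∫ a, w a i ^ 2 ∂μ - Q) := by
    intro i
    rw [(hsq i).2, hdiv]
    -- The mean-square-error identity cancels the constant `1/2` and the noise contribution, leaving
    -- only the deviation of the power from `Q`.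
    have : (v : ℝ) = v' - (1 - b) ^ 2 * Q - (a - b) ^ 2 * t := by linarith
    rw [this]
    field_simp
    ring
  simp only [hterm]
  rw [Finset.sum_add_distrib, Finset.sum_const, ← Finset.mul_sum, Finset.sum_sub_distrib]
  simp

end

/-! ### Power constraints -/

/-- Minkowski bound on the power of a sum, in terms of the powers of the summands. -/
lemma sum_integral_add_sq_le {ι A : Type*} [Fintype ι] [MeasurableSpace A] (μ : Measure A)
    {X S : A → ι → ℝ} (hX : ∀ i, MemLp (fun a => X a i) 2 μ)
    (hS : ∀ i, MemLp (fun a => S a i) 2 μ) {n P σ : ℝ} (hn : 0 ≤ n) (hP : 0 ≤ P) (hσ : 0 ≤ σ)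
    (hXP : ∑ i, ∫ a, X a i ^ 2 ∂μ ≤ n * P) (hSσ : ∑ i, ∫ a, S a i ^ 2 ∂μ = n * σ ^ 2) :
    ∑ i, ∫ a, (X a i + S a i) ^ 2 ∂μ ≤ n * (σ + Real.sqrt P) ^ 2 := by
  have hXS : ∀ i, Integrable (fun a => X a i * S a i) μ := fun i => (hX i).integrable_mul (hS i)
  have hexp : ∀ l : ℝ, ∑ i, ∫ a, (X a i + l * S a i) ^ 2 ∂μ =
      ∑ i, ∫ a, X a i ^ 2 ∂μ + 2 * l * ∑ i, ∫ a, X a i * S a i ∂μ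
        + l ^ 2 * ∑ i, ∫ a, S a i ^ 2 ∂μ := by
    intro l
    rw [Finset.mul_sum, Finset.mul_sum, ← Finset.sum_add_distrib, ← Finset.sum_add_distrib]
    refine Finset.sum_congr rfl fun i _ => ?_
    have heq : ∀ a, (X a i + l * S a i) ^ 2 =
        X a i ^ 2 + 2 * l * (X a i * S a i) + l ^ 2 * S a i ^ 2 := fun a => by ring
    simp only [heq]
    have h1 : Integrable (fun a => X a i ^ 2 + 2 * l * (X a i * S a i)) μ :=
      (hX i).integrable_sq.add ((hXS i).const_mul _)
    rw [integral_add h1 ((hS i).integrable_sq.const_mul _),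
      integral_add (hX i).integrable_sq ((hXS i).const_mul _), integral_const_mul,
      integral_const_mul]
  have hnonneg : ∀ l : ℝ, 0 ≤ ∑ i, ∫ a, (X a i + l * S a i) ^ 2 ∂μ := fun l =>
    Finset.sum_nonneg fun i _ => integral_nonneg fun a => sq_nonneg _
  have h1 := hexp 1
  simp only [one_mul, mul_one, one_pow] at h1
  rw [h1]
  set a := ∑ i, ∫ a, X a i ^ 2 ∂μ
  set c := ∑ i, ∫ a, X a i * S a i ∂μ
  set b := ∑ i, ∫ a, S a i ^ 2 ∂μ
  -- The power of `X + l S` is a nonnegative quadratic in `l`; its discriminant gives Cauchy-Schwarz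
  -- for the sum over letters and the expectation at once.
  have hd := discrim_le_zero (a := b) (b := 2 * c) (c := a) fun l => by
    have := hnonneg l
    rw [hexp l] at this
    linarith
  rw [discrim] at hd
  have hsq : Real.sqrt P ^ 2 = P := Real.sq_sqrt hP
  have hb : 0 ≤ b := by rw [hSσ]; positivity
  have hc : c ^ 2 ≤ (n * (σ * Real.sqrt P)) ^ 2 := by
    have : c ^ 2 ≤ a * b := by linarith
    have h2 : a * b ≤ n * P * b := mul_le_mul_of_nonneg_right hXP hb
    have h3 : (n * (σ * Real.sqrt P)) ^ 2 = n * P * b := by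
      rw [hSσ, mul_pow, mul_pow, hsq]; ring
    linarith
  have hc' : c ≤ n * (σ * Real.sqrt P) :=
    (abs_le_of_sq_le_sq' hc (by positivity)).2
  have : n * (σ + Real.sqrt P) ^ 2 = n * σ ^ 2 + 2 * (n * (σ * Real.sqrt P)) + n * P := by
    rw [add_sq, hsq]; ring
  linarith

/-- A finite power constraint in extended reals gives square integrability and a real bound. -/
lemma memLp_of_sum_lintegral_le {ι A : Type*} [Fintype ι] [MeasurableSpace A] (μ : Measure A)
    {X : A → ι → ℝ} (hX : Measurable X) {P : ℝ} (hP : 0 ≤ P)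
    (h : ∑ i, ∫⁻ a, ENNReal.ofReal (X a i ^ 2) ∂μ ≤ ENNReal.ofReal P) :
    (∀ i, MemLp (fun a => X a i) 2 μ) ∧ ∑ i, ∫ a, X a i ^ 2 ∂μ ≤ P := by
  have hm : ∀ i, AEStronglyMeasurable (fun a => X a i ^ 2) μ := fun i =>
    Measurable.aestronglyMeasurable (by fun_prop)
  have hfin : ∀ i, ∫⁻ a, ENNReal.ofReal (X a i ^ 2) ∂μ ≠ ∞ := fun i =>
    ne_top_of_le_ne_top ENNReal.ofReal_ne_top
      ((Finset.single_le_sum (f := fun i => ∫⁻ a, ENNReal.ofReal (X a i ^ 2) ∂μ)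
        (fun _ _ => zero_le) (Finset.mem_univ i)).trans h)
  constructor
  · intro i
    refine (memLp_two_iff_integrable_sq (Measurable.aestronglyMeasurable (by fun_prop))).2 ?_
    exact (lintegral_ofReal_ne_top_iff_integrable (hm i) (ae_of_all _ fun a => sq_nonneg _)).1
      (hfin i)
  · have heq : ∀ i, ∫ a, X a i ^ 2 ∂μ = (∫⁻ a, ENNReal.ofReal (X a i ^ 2) ∂μ).toReal := fun i =>
      integral_eq_lintegral_of_nonneg_ae (ae_of_all _ fun a => sq_nonneg _) (hm i)
    simp only [heq]
    rw [← ENNReal.toReal_sum fun i _ => hfin i]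
    exact ENNReal.toReal_le_of_le_ofReal hP h

/-! ### Block laws and the converse -/

/-- Joint law of state and input in a block. -/
noncomputable abbrev stateInputLaw (σs : ℝ) {n : ℕ} (κ : Kernel (Fin n → ℝ) (Fin n → ℝ)) :
    Measure ((Fin n → ℝ) × (Fin n → ℝ)) :=
  (Measure.pi fun _ : Fin n => gauss σs) ⊗ₘ κ

/-- State plus input. -/
def channelSum {n : ℕ} (p : (Fin n → ℝ) × (Fin n → ℝ)) : Fin n → ℝ := p.2 + p.1

lemma measurable_channelSum {n : ℕ} : Measurable (channelSum (n := n)) := by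
  unfold channelSum; fun_prop

lemma measurable_bobSeq {n : ℕ} : Measurable (bobSeq (n := n)) := by
  unfold bobSeq inputSeq stateSeq; fun_prop

lemma measurable_eveSeq {n : ℕ} : Measurable (eveSeq (n := n)) := by
  unfold eveSeq inputSeq stateSeq; fun_prop

lemma pi_map_noise {n : ℕ} {ν : Measure (ℝ × ℝ)} [IsProbabilityMeasure ν] {g : ℝ × ℝ → ℝ}
    (hg : Measurable g) {s : ℝ≥0} (h : ν.map g = gaussianReal 0 s) :
    (Measure.pi fun _ : Fin n => ν).map (fun w i => g (w i)) = noise (Fin n) s := by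
  have : IsProbabilityMeasure (ν.map g) := Measure.isProbabilityMeasure_map hg.aemeasurable
  rw [Measure.pi_map_pi (μ := fun _ : Fin n => ν) (f := fun _ => g) (fun i => hg.aemeasurable), h]

section
variable {σs : ℝ} {ν : Measure (ℝ × ℝ)} [IsProbabilityMeasure ν] {n : ℕ}
  {κ : Kernel (Fin n → ℝ) (Fin n → ℝ)}

lemma blockLaw_map_pair {g : ℝ × ℝ → ℝ} (hg : Measurable g) {s : ℝ≥0}
    (h : ν.map g = gaussianReal 0 s) :
    (blockLaw σs ν κ).map (fun ω => (ω.1, channelSum ω.1 + fun i => g (ω.2 i))) =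
      ((stateInputLaw σs κ).prod (noise (Fin n) s)).map
        (fun p => (p.1, channelSum p.1 + p.2)) := by
  have hc := measurable_channelSum (n := n)
  have h1 := Measure.map_prod_map (stateInputLaw σs κ) (Measure.pi fun _ : Fin n => ν)
    (f := id) (g := fun w i => g (w i)) measurable_id (by fun_prop)
  rw [Measure.map_id, pi_map_noise hg h] at h1
  rw [h1, Measure.map_map (by fun_prop) (by fun_prop)]
  rfl

lemma blockLaw_map_bob {s : ℝ≥0} (h : ν.fst = gaussianReal 0 s) :
    (blockLaw σs ν κ).map (fun ω => (ω.1, bobSeq ω)) =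
      ((stateInputLaw σs κ).prod (noise (Fin n) s)).map
        (fun p => (p.1, channelSum p.1 + p.2)) :=
  blockLaw_map_pair measurable_fst h

lemma blockLaw_map_eve {s : ℝ≥0} (h : ν.snd = gaussianReal 0 s) :
    (blockLaw σs ν κ).map (fun ω => (ω.1, eveSeq ω)) =
      ((stateInputLaw σs κ).prod (noise (Fin n) s)).map
        (fun p => (p.1, channelSum p.1 + p.2)) :=
  blockLaw_map_pair measurable_snd h

lemma map_comp_eq_of_map_eq {α β γ δ : Type*} [MeasurableSpace α] [MeasurableSpace β]
    [MeasurableSpace γ] [MeasurableSpace δ] {P : Measure α} {P' : Measure β} {f : α → γ}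
    {f' : β → γ} (hf : Measurable f) (hf' : Measurable f') (h : P.map f = P'.map f')
    {g : γ → δ} (hg : Measurable g) : P.map (fun x => g (f x)) = P'.map (fun x => g (f' x)) := by
  have := congrArg (Measure.map g) h
  rwa [Measure.map_map hg hf, Measure.map_map hg hf'] at this

/-- Mutual information only depends on the law of the pair. -/
lemma mutualInfo_fst_congr {α β γ 𝓢 𝓣 : Type*} [MeasurableSpace α] [MeasurableSpace β]
    [MeasurableSpace γ] [MeasurableSpace 𝓢] [MeasurableSpace 𝓣] {P : Measure α} {P' : Measure β}
    {T : α → 𝓣} {T' : β → 𝓣} {Y : α → γ} {Y' : β → γ} (hT : Measurable T) (hT' : Measurable T')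
    (hY : Measurable Y) (hY' : Measurable Y')
    (h : P.map (fun ω => (T ω, Y ω)) = P'.map fun ω => (T' ω, Y' ω)) {f : 𝓣 → 𝓢}
    (hf : Measurable f) :
    mutualInfo (fun ω => f (T ω)) Y P = mutualInfo (fun ω => f (T' ω)) Y' P' := by
  have hm : Measurable fun ω => (T ω, Y ω) := by fun_prop
  have hm' : Measurable fun ω => (T' ω, Y' ω) := by fun_prop
  have h1 := map_comp_eq_of_map_eq hm hm' h (g := fun p => (f p.1, p.2)) (by fun_prop)
  have h2 := map_comp_eq_of_map_eq hm hm' h (g := fun p => f p.1) (by fun_prop)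
  have h3 := map_comp_eq_of_map_eq hm hm' h (g := fun p => p.2) (by fun_prop)
  unfold mutualInfo
  rw [h1, h2, h3]

/-- The block is replaced by the backward coupling, which keeps the law of (state, input) with each
output separately but in general changes the joint law of the outputs. Conditioning on the pair
(state, input), not on the state alone, makes the channel sum known and the backward divergence
computable. -/
lemma mutualInfo_bob_le [IsMarkovKernel κ] {s t : ℝ≥0} (hs : 0 < s) (hst : s ≤ t)
    (hN : ν.fst = gaussianReal 0 s)
    (hNz : ν.snd = gaussianReal 0 t) {Q : ℝ} (hQ : 0 ≤ Q)
    (hw : ∀ i, MemLp (fun p => channelSum p i) 2 (stateInputLaw σs κ)) :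
    mutualInfo stateSeq bobSeq (blockLaw σs ν κ) ≤ mutualInfo stateSeq eveSeq (blockLaw σs ν κ) +
      bwdDiv Q s t n (∑ i, ∫ p, channelSum p i ^ 2 ∂(stateInputLaw σs κ))
        / ENNReal.ofReal (Real.log 2) := by
  have hc := measurable_channelSum (n := n)
  set μ := stateInputLaw σs κ with hμ
  set v := bwdVar 0 s t with hv
  set a := bwdSlope 0 s t with ha
  set P := (μ.prod (noise (Fin n) t)).prod (noise (Fin n) v) with hP
  let Y : ((((Fin n → ℝ) × (Fin n → ℝ)) × (Fin n → ℝ)) × (Fin n → ℝ)) → Fin n → ℝ :=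
    fun ω => channelSum ω.1.1 + (a • ω.1.2 + ω.2)
  let Z : ((((Fin n → ℝ) × (Fin n → ℝ)) × (Fin n → ℝ)) × (Fin n → ℝ)) → Fin n → ℝ :=
    fun ω => channelSum ω.1.1 + ω.1.2
  have hY : Measurable Y := by fun_prop
  have hZ : Measurable Z := by fun_prop
  have hlawZ : P.map (fun ω => (ω.1.1, Z ω)) = (blockLaw σs ν κ).map fun ω => (ω.1, eveSeq ω) := by
    rw [blockLaw_map_eve hNz]
    have : (fun ω : ((((Fin n → ℝ) × (Fin n → ℝ)) × (Fin n → ℝ)) × (Fin n → ℝ)) =>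
      (ω.1.1, Z ω)) = (fun p => (p.1, channelSum p.1 + p.2)) ∘ Prod.fst := rfl
    rw [this, ← Measure.map_map (by fun_prop) (by fun_prop), hP, Measure.map_fst_prod]
    simp [hμ]
  have hlawY : P.map (fun ω => (ω.1.1, Y ω)) = (blockLaw σs ν κ).map fun ω => (ω.1, bobSeq ω) := by
    rw [blockLaw_map_bob hN, ← noise_prod_noise_map (ι := Fin n) (bwdVar_decomposition hs hst)]
    have h1 := Measure.map_prod_map μ ((noise (Fin n) t).prod (noise (Fin n) v)) (f := id)
      (g := fun p => a • p.1 + p.2) measurable_id (by fun_prop)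
    rw [Measure.map_id] at h1
    rw [h1, ← Measure.prodAssoc_prod, Measure.map_map (by fun_prop) (by fun_prop),
      Measure.map_map (by fun_prop) (by fun_prop)]
    rfl
  have hbob := mutualInfo_fst_congr (by fun_prop) measurable_fst hY measurable_bobSeq hlawY
    measurable_fst
  have heve := mutualInfo_fst_congr (by fun_prop) measurable_fst hZ measurable_eveSeq hlawZ
    measurable_fst
  change _ = mutualInfo stateSeq bobSeq _ at hbob
  change _ = mutualInfo stateSeq eveSeq _ at heve
  rw [← hbob, ← heve]
  unfold mutualInfo
  rw [← ENNReal.add_div]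
  refine ENNReal.div_le_div_right ?_ _
  have h := klDiv_prod_le_add P (T := fun ω => ω.1.1) (by fun_prop) measurable_fst hY hZ
    (m := fun z => bwdSlope Q s t • z) (by fun_prop) (noise (Fin n) (bwdVar Q s t))
  rw [klDiv_backward μ hQ hs hst hc hw hP, Fintype.card_fin] at h
  exact h

end

lemma coherentRate_eq (σs P σ : ℝ) : coherentRate σs P σ =
    (1 / 2 * Real.log (1 + (σs + Real.sqrt P) ^ 2 / ((σ ^ 2).toNNReal : ℝ≥0))) / Real.log 2 := by
  rw [coherentRate, Real.logb, Real.coe_toNNReal _ (sq_nonneg σ), mul_div_assoc]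

lemma coherentRate_nonneg (σs P σ : ℝ) : 0 ≤ coherentRate σs P σ := by
  rw [coherentRate]
  have : (1 : ℝ) ≤ 1 + (σs + Real.sqrt P) ^ 2 / σ ^ 2 := by
    have := div_nonneg (sq_nonneg (σs + Real.sqrt P)) (sq_nonneg σ); linarith
  have := Real.logb_nonneg one_lt_two this
  positivity

lemma half_log_ratio_eq (σs P σn σz : ℝ) :
    1 / 2 * Real.log ((1 + (σs + Real.sqrt P) ^ 2 / ((σn ^ 2).toNNReal : ℝ≥0)) /
      (1 + (σs + Real.sqrt P) ^ 2 / ((σz ^ 2).toNNReal : ℝ≥0))) =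
    (coherentRate σs P σn - coherentRate σs P σz) * Real.log 2 := by
  have hl : Real.log 2 ≠ 0 := (Real.log_pos one_lt_two).ne'
  rw [coherentRate_eq, coherentRate_eq, Real.log_div (by positivity) (by positivity)]
  field_simp

lemma ofReal_mul_log_two_div (x : ℝ) :
    ENNReal.ofReal (x * Real.log 2) / ENNReal.ofReal (Real.log 2) = ENNReal.ofReal x := by
  have hl : 0 < Real.log 2 := Real.log_pos one_lt_two
  rw [← ENNReal.ofReal_div_of_pos hl, mul_div_assoc, div_self hl.ne', mul_one]

lemma ofReal_nat_mul_div {n : ℕ} (hn : 1 ≤ n) (x : ℝ) :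
    ENNReal.ofReal (n * x) / n = ENNReal.ofReal x := by
  rw [← ENNReal.ofReal_natCast n, ← ENNReal.ofReal_div_of_pos (by positivity)]
  congr 1
  field_simp

lemma bwdDiv_le {σs P σn σz : ℝ} (n : ℕ) {p : ℝ} (hp : p ≤ n * (σs + Real.sqrt P) ^ 2) :
    bwdDiv ((σs + Real.sqrt P) ^ 2) (σn ^ 2).toNNReal (σz ^ 2).toNNReal n p
        / ENNReal.ofReal (Real.log 2) ≤
      ENNReal.ofReal (n * (coherentRate σs P σn - coherentRate σs P σz)) := by
  rw [← ofReal_mul_log_two_div (n * (coherentRate σs P σn - coherentRate σs P σz))]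
  refine ENNReal.div_le_div_right (ENNReal.ofReal_le_ofReal ?_) _
  rw [half_log_ratio_eq]
  -- The coefficient of the power excess is nonnegative, so power below `nQ` only lowers the
  -- divergence.
  have h : (1 - bwdSlope ((σs + Real.sqrt P) ^ 2) (σn ^ 2).toNNReal (σz ^ 2).toNNReal) ^ 2 /
      (2 * bwdVar ((σs + Real.sqrt P) ^ 2) (σn ^ 2).toNNReal (σz ^ 2).toNNReal) *
      (p - n * (σs + Real.sqrt P) ^ 2) ≤ 0 :=
    mul_nonpos_of_nonneg_of_nonpos (by positivity) (by linarith)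
  linarith

/-- The converse: no encoder gains more than the coherent rate difference. -/
lemma amplificationRate_le {σs σn σz P : ℝ} (hσs : 0 < σs) (hσn : 0 < σn)
    (hP : 0 ≤ P) (hdeg : σn ^ 2 ≤ σz ^ 2) {ν : Measure (ℝ × ℝ)} [IsProbabilityMeasure ν]
    (hN : ν.fst = gaussianReal 0 (σn ^ 2).toNNReal)
    (hNz : ν.snd = gaussianReal 0 (σz ^ 2).toNNReal) {n : ℕ} (hn : 1 ≤ n)
    (κ : Kernel (Fin n → ℝ) (Fin n → ℝ)) [IsMarkovKernel κ]
    (hpow : averagePower σs ν κ ≤ ENNReal.ofReal P) :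
    amplificationRate σs ν κ ≤ leakageRate σs ν κ +
      ENNReal.ofReal (coherentRate σs P σn - coherentRate σs P σz) := by
  have hn0 : (n : ℝ≥0∞) ≠ 0 := by simpa using (by omega : n ≠ 0)
  have hpow' : ∑ i, ∫⁻ p, ENNReal.ofReal (p.2 i ^ 2) ∂(stateInputLaw σs κ) ≤
      ENNReal.ofReal (n * P) := by
    rw [averagePower, ENNReal.div_le_iff hn0 (by simp)] at hpow
    rw [ENNReal.ofReal_mul (by positivity), ENNReal.ofReal_natCast, mul_comm]
    refine le_trans (le_of_eq ?_) hpow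
    refine Finset.sum_congr rfl fun i _ => ?_
    rw [blockLaw, lintegral_prod _ (by unfold inputSeq; fun_prop)]
    simp [inputSeq]
  obtain ⟨hX, hXP⟩ := memLp_of_sum_lintegral_le (stateInputLaw σs κ) (X := fun p => p.2)
    measurable_snd (by positivity) hpow'
  have hfst : (stateInputLaw σs κ).map Prod.fst = noise (Fin n) (σs ^ 2).toNNReal :=
    Measure.fst_compProd _ _
  have hmp : MeasurePreserving Prod.fst (stateInputLaw σs κ) (noise (Fin n) (σs ^ 2).toNNReal) :=
    ⟨measurable_fst, hfst⟩
  have hS : ∀ i, MemLp (fun p => p.1 i) 2 (stateInputLaw σs κ) := fun i =>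
    (memLp_eval_noise _ i).comp_measurePreserving hmp
  have hSσ : ∑ i, ∫ p, p.1 i ^ 2 ∂(stateInputLaw σs κ) = n * σs ^ 2 := by
    have : ∀ i, ∫ p, p.1 i ^ 2 ∂(stateInputLaw σs κ) = σs ^ 2 := fun i => by
      have h := integral_eval_sq_noise (ι := Fin n) (σs ^ 2).toNNReal i
      rw [← hfst, integral_map (by fun_prop) (Measurable.aestronglyMeasurable (by fun_prop)),
        Real.coe_toNNReal _ (sq_nonneg σs)] at h
      exact h
    simp [this]
  have hw : ∀ i, MemLp (fun p => channelSum p i) 2 (stateInputLaw σs κ) := fun i =>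
    (hX i).add (hS i)
  have hsum := sum_integral_add_sq_le _ hX hS (Nat.cast_nonneg n) hP hσs.le hXP hSσ
  have hb := mutualInfo_bob_le (κ := κ) (σs := σs) (s := (σn ^ 2).toNNReal)
    (t := (σz ^ 2).toNNReal) (Real.toNNReal_pos.2 (by positivity)) (Real.toNNReal_le_toNNReal hdeg)
    hN hNz (sq_nonneg (σs + Real.sqrt P)) hw
  rw [amplificationRate, leakageRate, ← ofReal_nat_mul_div hn, ← ENNReal.add_div]
  refine ENNReal.div_le_div_right (hb.trans ?_) _
  gcongr
  exact bwdDiv_le n hsum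

/-! ### Uncoded transmission of a block -/

section
variable {σs : ℝ} {n : ℕ}

lemma stateInputLaw_uncoded (P : ℝ) : stateInputLaw σs (uncoded σs P n) =
    (noise (Fin n) (σs ^ 2).toNNReal).map (fun s => (s, fun i => Real.sqrt P / σs * s i)) := by
  rw [stateInputLaw, uncoded, Measure.compProd_deterministic]

instance (P : ℝ) : IsMarkovKernel (uncoded σs P n) := by
  unfold uncoded; infer_instance

/-- Information about the state in a receiver's output under the uncoded scheme. -/
lemma klDiv_uncoded (hσs : 0 < σs) (P : ℝ) {σ : ℝ} (hσ : 0 < σ) :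
    klDiv (((stateInputLaw σs (uncoded σs P n)).prod (noise (Fin n) (σ ^ 2).toNNReal)).map
        (fun p => (p.1.1, channelSum p.1 + p.2)))
      ((noise (Fin n) (σs ^ 2).toNNReal).prod
        (((stateInputLaw σs (uncoded σs P n)).prod (noise (Fin n) (σ ^ 2).toNNReal)).map
          (fun p => channelSum p.1 + p.2))) =
      ENNReal.ofReal (n * coherentRate σs P σ * Real.log 2) := by
  have hc := measurable_channelSum (n := n)
  set c := Real.sqrt P / σs + 1 with hcdef
  set s := (σ ^ 2).toNNReal with hs
  set r := (σs ^ 2).toNNReal with hr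
  have hsr : (s : ℝ) = σ ^ 2 := Real.coe_toNNReal _ (sq_nonneg σ)
  have hrr : (r : ℝ) = σs ^ 2 := Real.coe_toNNReal _ (sq_nonneg σs)
  have hcr : c ^ 2 * r = (σs + Real.sqrt P) ^ 2 := by
    rw [hrr, hcdef]; field_simp; ring
  -- The variance of the output `c S + N`, with `c S` of power `(σs + √P)²`. With it the centred
  -- Gaussian reference is the true output law, so the quadratic terms of the divergence cancel and
  -- the logarithm remains.
  set v' : ℝ≥0 := ⟨c ^ 2 * r + s, by positivity⟩ with hv'
  have hv'r : (v' : ℝ) = c ^ 2 * r + s := rfl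
  have hspos : (0 : ℝ) < s := by rw [hsr]; positivity
  have hs0 : s ≠ 0 := by rintro h; simp [h] at hspos
  have hv'pos : (0 : ℝ) < v' := by rw [hv'r]; positivity
  have hv'0 : v' ≠ 0 := by rintro h; simp [h] at hv'pos
  have h1 := Measure.map_prod_map (noise (Fin n) r) (noise (Fin n) s)
    (f := fun s => (s, fun i => Real.sqrt P / σs * s i)) (g := id) (by fun_prop) measurable_id
  rw [Measure.map_id, ← stateInputLaw_uncoded] at h1
  rw [h1, Measure.map_map (by fun_prop) (by fun_prop), Measure.map_map (by fun_prop) (by fun_prop)]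
  have e1 : ((fun p : ((Fin n → ℝ) × (Fin n → ℝ)) × (Fin n → ℝ) => channelSum p.1 + p.2) ∘
      Prod.map (fun s => (s, fun i => Real.sqrt P / σs * s i)) id) = fun p => c • p.1 + p.2 := by
    ext p i
    simp [channelSum, hcdef]
    ring
  have e2 : ((fun p : ((Fin n → ℝ) × (Fin n → ℝ)) × (Fin n → ℝ) =>
      (p.1.1, channelSum p.1 + p.2)) ∘
      Prod.map (fun s => (s, fun i => Real.sqrt P / σs * s i)) id) =
      fun p => (p.1, c • p.1 + p.2) := by
    ext p : 1
    exact Prod.ext rfl (congrFun e1 p)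
  rw [e1, e2, noise_prod_noise_map hv'r,
    klDiv_shear_noise (d := fun s => c • s) _ hs0 hv'0 (by fun_prop)
      (fun i => (memLp_eval_noise r i).const_mul c)]
  congr 1
  have hterm : ∀ i, ∫ a, (c • a) i ^ 2 ∂(noise (Fin n) r) = c ^ 2 * r := fun i => by
    simp only [Pi.smul_apply, smul_eq_mul, mul_pow]
    rw [integral_const_mul, integral_eval_sq_noise]
  have hdiv : (v' : ℝ) / s = 1 + (σs + Real.sqrt P) ^ 2 / s := by
    rw [hv'r, hcr]; field_simp; ring
  have hl : Real.log 2 ≠ 0 := (Real.log_pos one_lt_two).ne'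
  simp only [hterm, ← hv'r, hdiv]
  rw [coherentRate_eq, ← hs]
  simp only [Finset.sum_const, Finset.card_univ, Fintype.card_fin, nsmul_eq_mul]
  field_simp
  ring

variable {ν : Measure (ℝ × ℝ)}

lemma mutualInfo_uncoded (hσs : 0 < σs) (P : ℝ) {σ : ℝ} (hσ : 0 < σ)
    {Y : Block n → Fin n → ℝ} (hY : Measurable Y)
    (hlaw : (blockLaw σs ν (uncoded σs P n)).map (fun ω => (ω.1, Y ω)) =
      ((stateInputLaw σs (uncoded σs P n)).prod (noise (Fin n) (σ ^ 2).toNNReal)).map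
        (fun p => (p.1, channelSum p.1 + p.2))) :
    mutualInfo stateSeq Y (blockLaw σs ν (uncoded σs P n)) =
      ENNReal.ofReal (n * coherentRate σs P σ) := by
  have hc := measurable_channelSum (n := n)
  have h := mutualInfo_fst_congr measurable_fst measurable_fst hY (by fun_prop) hlaw
    measurable_fst
  change mutualInfo stateSeq Y _ = _ at h
  rw [h, mutualInfo]
  have hfst : ((stateInputLaw σs (uncoded σs P n)).prod
      (noise (Fin n) (σ ^ 2).toNNReal)).map (fun p => p.1.1) =
      noise (Fin n) (σs ^ 2).toNNReal := by
    have e : (fun p : ((Fin n → ℝ) × (Fin n → ℝ)) × (Fin n → ℝ) => p.1.1) =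
      Prod.fst ∘ Prod.fst := rfl
    rw [e, ← Measure.map_map (by fun_prop) (by fun_prop), Measure.map_fst_prod]
    simp only [measure_univ, one_smul]
    exact Measure.fst_compProd _ _
  rw [hfst, klDiv_uncoded hσs P hσ, ofReal_mul_log_two_div]

variable [IsProbabilityMeasure ν]

lemma averagePower_uncoded_le (hσs : 0 < σs) {P : ℝ} (hP : 0 ≤ P) (hn : 1 ≤ n) :
    averagePower σs ν (uncoded σs P n) ≤ ENNReal.ofReal P := by
  have hn0 : (n : ℝ≥0∞) ≠ 0 := by simpa using (by omega : n ≠ 0)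
  have hterm : ∀ i, ∫⁻ ω, ENNReal.ofReal (inputSeq ω i ^ 2) ∂(blockLaw σs ν (uncoded σs P n)) =
      ENNReal.ofReal P := by
    intro i
    rw [blockLaw, lintegral_prod _ (by unfold inputSeq; fun_prop)]
    simp only [inputSeq, lintegral_const, measure_univ, mul_one]
    change ∫⁻ p, ENNReal.ofReal (p.2 i ^ 2) ∂(stateInputLaw σs (uncoded σs P n)) = _
    rw [stateInputLaw_uncoded, lintegral_map (by fun_prop) (by fun_prop),
      ← ofReal_integral_eq_lintegral_ofReal
        ((memLp_eval_noise _ i).const_mul _).integrable_sq (ae_of_all _ fun _ => sq_nonneg _)]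
    simp only [mul_pow]
    rw [integral_const_mul, integral_eval_sq_noise, Real.coe_toNNReal _ (sq_nonneg σs), div_pow,
      Real.sq_sqrt hP]
    congr 1
    field_simp
  rw [averagePower, ENNReal.div_le_iff hn0 (by simp)]
  simp [hterm, mul_comm]

lemma amplificationRate_uncoded (hσs : 0 < σs) (P : ℝ) (hn : 1 ≤ n) {σn : ℝ} (hσn : 0 < σn)
    (hN : ν.fst = gaussianReal 0 (σn ^ 2).toNNReal) :
    amplificationRate σs ν (uncoded σs P n) = ENNReal.ofReal (coherentRate σs P σn) := by
  rw [amplificationRate, mutualInfo_uncoded hσs P hσn measurable_bobSeq (blockLaw_map_bob hN),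
    ofReal_nat_mul_div hn]

lemma leakageRate_uncoded (hσs : 0 < σs) (P : ℝ) (hn : 1 ≤ n) {σz : ℝ} (hσz : 0 < σz)
    (hNz : ν.snd = gaussianReal 0 (σz ^ 2).toNNReal) :
    leakageRate σs ν (uncoded σs P n) = ENNReal.ofReal (coherentRate σs P σz) := by
  rw [leakageRate, mutualInfo_uncoded hσs P hσz measurable_eveSeq (blockLaw_map_eve hNz),
    ofReal_nat_mul_div hn]

end

/-! ### The scalar backward channel and conditional information -/

section
variable {Q : ℝ} {s t : ℝ≥0}

lemma gaussianReal_map_unit (v : ℝ≥0) :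
    (gaussianReal 0 v).map (fun x (_ : Unit) => x) = noise Unit v := by
  have h := (measurePreserving_piUnique (fun _ : Unit => gaussianReal 0 v)).symm.map_eq
  exact h

lemma klDiv_backward_real {A : Type*} [MeasurableSpace A] (μ : Measure A)
    [IsProbabilityMeasure μ] (hQ : 0 ≤ Q) (hs : 0 < s) (hst : s ≤ t) {w : A → ℝ}
    (hw : Measurable w) (hw2 : MemLp w 2 μ) {P : Measure ((A × ℝ) × ℝ)}
    (hP : P = (μ.prod (gaussianReal 0 t)).prod (gaussianReal 0 (bwdVar 0 s t))) :
    klDiv (P.map fun ω => ((ω.1.1, w ω.1.1 + ω.1.2), w ω.1.1 + (bwdSlope 0 s t * ω.1.2 + ω.2)))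
      (((P.map fun ω => (ω.1.1, w ω.1.1 + ω.1.2)).prod (gaussianReal 0 (bwdVar Q s t))).map
        fun p => (p.1, bwdSlope Q s t * p.1.2 + p.2)) =
      bwdDiv Q s t 1 (∫ a, w a ^ 2 ∂μ) := by
  have : IsProbabilityMeasure P := by rw [hP]; infer_instance
  -- The scalar statement is the vector one over the one-point index type, transported along the
  -- identification of `ℝ` with `Unit → ℝ`.
  let j : (A × ℝ) × ℝ → (A × (Unit → ℝ)) × (Unit → ℝ) :=
    fun p => ((p.1.1, fun _ => p.1.2), fun _ => p.2)
  let e : (A × ℝ) × ℝ ≃ᵐ (A × (Unit → ℝ)) × (Unit → ℝ) :=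
    { toFun := j
      invFun := fun p => ((p.1.1, p.1.2 ()), p.2 ())
      left_inv := fun p => rfl
      right_inv := fun p => rfl
      measurable_toFun := by simp only [Equiv.coe_fn_mk]; fun_prop
      measurable_invFun := by simp only [Equiv.coe_fn_symm_mk]; fun_prop }
  have he : (e : (A × ℝ) × ℝ → _) = j := rfl
  have hj : Measurable j := by fun_prop
  have hw' : Measurable fun (a : A) (_ : Unit) => w a := by fun_prop
  have hlift : ∀ (L : Measure (A × ℝ)) [IsProbabilityMeasure L] (v : ℝ≥0),
      (L.prod (gaussianReal 0 v)).map j =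
        (L.map fun p => (p.1, fun _ : Unit => p.2)).prod (noise Unit v) := by
    intro L _ v
    rw [← gaussianReal_map_unit, Measure.map_prod_map _ _ (by fun_prop) (by fun_prop)]
    rfl
  have hPj : P.map j = (μ.prod (noise Unit t)).prod (noise Unit (bwdVar 0 s t)) := by
    have h := Measure.map_prod_map μ (gaussianReal 0 t) (f := id) (g := fun x (_ : Unit) => x)
      measurable_id (by fun_prop)
    rw [Measure.map_id, gaussianReal_map_unit] at h
    rw [hP, hlift, h]
    rfl
  have hk := klDiv_backward μ hQ hs hst hw' (fun _ => hw2) hPj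
  simp only [Finset.univ_unique, Finset.sum_const, Finset.card_singleton, one_smul,
    Fintype.card_unit] at hk
  rw [← hk]
  have : IsProbabilityMeasure (P.map fun ω => (ω.1.1, w ω.1.1 + ω.1.2)) :=
    Measure.isProbabilityMeasure_map (by fun_prop)
  have : IsProbabilityMeasure (P.map fun ω => ((ω.1.1, w ω.1.1 + ω.1.2),
      w ω.1.1 + (bwdSlope 0 s t * ω.1.2 + ω.2))) :=
    Measure.isProbabilityMeasure_map (by fun_prop)
  have : IsProbabilityMeasure (((P.map fun ω => (ω.1.1, w ω.1.1 + ω.1.2)).prod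
      (gaussianReal 0 (bwdVar Q s t))).map fun p => (p.1, bwdSlope Q s t * p.1.2 + p.2)) :=
    Measure.isProbabilityMeasure_map (by fun_prop)
  rw [← klDiv_map_measurableEquiv e, he, Measure.map_map hj (by fun_prop),
    Measure.map_map hj (by fun_prop), Measure.map_map (by fun_prop) hj,
    Measure.map_map (by fun_prop) hj]
  congr 1
  have h2 : ((fun ω : (A × (Unit → ℝ)) × (Unit → ℝ) =>
      (ω.1.1, (fun _ : Unit => w ω.1.1) + ω.1.2)) ∘ j) =
      (fun p => (p.1, fun _ : Unit => p.2)) ∘ fun ω => (ω.1.1, w ω.1.1 + ω.1.2) := rfl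
  have h3 := Measure.map_map (μ := P) (g := fun p : A × ℝ => (p.1, fun _ : Unit => p.2))
    (f := fun ω => (ω.1.1, w ω.1.1 + ω.1.2)) (by fun_prop) (by fun_prop)
  rw [h2, ← h3, ← hlift, Measure.map_map (by fun_prop) hj]
  rfl

lemma prodMkLeft_addNoise {A B C : Type*} [MeasurableSpace A] [MeasurableSpace B]
    [MeasurableSpace C] [Add B] [MeasurableAdd₂ B] {m : C → B} (hm : Measurable m)
    (ρ : Measure B) [IsProbabilityMeasure ρ] :
    (addNoise m ρ).prodMkLeft A = addNoise (fun p : A × C => m p.2) ρ := by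
  ext1 p
  refine Measure.ext_of_lintegral _ fun g hg => ?_
  rw [Kernel.prodMkLeft_apply, addNoise, addNoise, Kernel.lintegral_map _ (by fun_prop) _ hg,
    Kernel.lintegral_map _ (by fun_prop) _ hg, Kernel.lintegral_prod _ _ _ (by fun_prop),
    Kernel.lintegral_prod _ _ _ (by fun_prop)]
  simp only [Kernel.id_apply, Kernel.const_apply]
  rw [lintegral_dirac' _ (by fun_prop), lintegral_dirac' _ (by fun_prop)]

/-- Conditional mutual information of the noisy outputs of a scalar degraded channel, up to the
divergence of the output pair from the Gaussian backward channel. -/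
lemma add_klDiv_condDistrib_degraded {A : Type*} [MeasurableSpace A] [StandardBorelSpace A]
    [Nonempty A] (μ : Measure A) [IsProbabilityMeasure μ] (hQ : 0 ≤ Q) (hs : 0 < s) {δ : ℝ≥0}
    (hδ : (t : ℝ) = s + δ) {w : A → ℝ} (hw : Measurable w) (hw2 : MemLp w 2 μ)
    {P : Measure (A × ℝ × ℝ)}
    (hP : P = μ.prod ((gaussianReal 0 s).prod (gaussianReal 0 δ))) [IsProbabilityMeasure P] :
    klDiv (P.map fun ω => (w ω.1 + ω.2.1 + ω.2.2, w ω.1 + ω.2.1))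
        (((P.map fun ω => w ω.1 + ω.2.1 + ω.2.2).prod (gaussianReal 0 (bwdVar Q s t))).map
          fun p => (p.1, bwdSlope Q s t * p.1 + p.2)) +
      klDiv (P.map fun ω => (w ω.1 + ω.2.1 + ω.2.2, (ω.1, w ω.1 + ω.2.1)))
        ((P.map fun ω => w ω.1 + ω.2.1 + ω.2.2) ⊗ₘ
          (condDistrib (fun ω => ω.1) (fun ω => w ω.1 + ω.2.1 + ω.2.2) P ×ₖ
            condDistrib (fun ω => w ω.1 + ω.2.1) (fun ω => w ω.1 + ω.2.1 + ω.2.2) P)) =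
      bwdDiv Q s t 1 (∫ a, w a ^ 2 ∂μ) := by
  have hst : s ≤ t := by
    rw [← NNReal.coe_le_coe, hδ]; exact le_add_of_nonneg_right δ.coe_nonneg
  have htpos : (0 : ℝ) < t := by exact_mod_cast hs.trans_le hst
  have hm : Measurable fun z : ℝ => bwdSlope Q s t * z := by fun_prop
  have := isMarkovKernel_addNoise hm (gaussianReal 0 (bwdVar Q s t))
  have hadd := klDiv_condDistrib_add P (T := fun ω => ω.1) (Y := fun ω => w ω.1 + ω.2.1)
    (Z := fun ω => w ω.1 + ω.2.1 + ω.2.2) (by fun_prop) (by fun_prop) (by fun_prop)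
    (addNoise (fun z => bwdSlope Q s t * z) (gaussianReal 0 (bwdVar Q s t)))
  rw [prodMkLeft_addNoise hm, compProd_addNoise (by fun_prop), compProd_addNoise hm] at hadd
  rw [← hadd, ← klDiv_backward_real μ hQ hs hst hw hw2 rfl]
  set P' := (μ.prod (gaussianReal 0 t)).prod (gaussianReal 0 (bwdVar 0 s t))
  have hdeg := gaussianReal_degraded_eq (a := bwdSlope 0 s t) (v := bwdVar 0 s t) hδ
    (by rw [bwdSlope]; field_simp; ring) (bwdVar_decomposition hs hst)
  -- Here the outputs are physically degraded, so the full joint law agrees with the backward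
  -- coupling, not just its two marginals. This is what turns the block inequality into an identity.
  have hlaw : P.map (fun ω => (ω.1, (ω.2.1, ω.2.1 + ω.2.2))) =
      P'.map fun ω => (ω.1.1, (bwdSlope 0 s t * ω.1.2 + ω.2, ω.1.2)) := by
    have h1 := Measure.map_prod_map μ ((gaussianReal 0 s).prod (gaussianReal 0 δ)) (f := id)
      (g := fun p => (p.1, p.1 + p.2)) measurable_id (by fun_prop)
    have h2 := Measure.map_prod_map μ ((gaussianReal 0 t).prod (gaussianReal 0 (bwdVar 0 s t)))
      (f := id) (g := fun p => (bwdSlope 0 s t * p.1 + p.2, p.1)) measurable_id (by fun_prop)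
    rw [hdeg] at h1
    have h3 := h1.symm.trans h2
    rw [← hP, ← Measure.prodAssoc_prod, Measure.map_map (by fun_prop) (by fun_prop)] at h3
    exact h3
  have e1 := map_comp_eq_of_map_eq (by fun_prop) (by fun_prop) hlaw
    (g := fun p : A × ℝ × ℝ => ((p.1, w p.1 + p.2.2), w p.1 + p.2.1)) (by fun_prop)
  have e2 := map_comp_eq_of_map_eq (by fun_prop) (by fun_prop) hlaw
    (g := fun p : A × ℝ × ℝ => (p.1, w p.1 + p.2.2)) (by fun_prop)
  simp only [← add_assoc] at e1 e2 ⊢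
  rw [e1, e2]

end

/-! ### The single-letter maximum -/

section
variable {σs σn σz P : ℝ}

lemma coe_toNNReal_degraded (hdeg : σn ^ 2 ≤ σz ^ 2) :
    ((σz ^ 2).toNNReal : ℝ) = (σn ^ 2).toNNReal + (σz ^ 2 - σn ^ 2).toNNReal := by
  rw [Real.coe_toNNReal _ (sq_nonneg _), Real.coe_toNNReal _ (sq_nonneg _),
    Real.coe_toNNReal _ (sub_nonneg.2 hdeg)]
  ring

/-- Law of input and state in a single letter. -/
noncomputable abbrev inputStateLaw (σs : ℝ) (κ : Kernel ℝ ℝ) : Measure (ℝ × ℝ) :=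
  (gauss σs ⊗ₘ κ).map Prod.swap

/-- The divergence on the left is the slack in the bound on the conditional information. Writing the
identity as a sum avoids truncated subtraction: dropping the slack gives the upper bound, and its
vanishing gives equality. -/
lemma add_letterCondInfo (hσn : 0 < σn) (hdeg : σn ^ 2 ≤ σz ^ 2) {Q : ℝ} (hQ : 0 ≤ Q)
    (κ : Kernel ℝ ℝ) [IsMarkovKernel κ]
    (hw : MemLp (fun p => p.1 + p.2) 2 (inputStateLaw σs κ)) :
    klDiv ((letterLaw σs σn σz κ).map fun ω =>
          (ω.1.2 + ω.1.1 + ω.2.1 + ω.2.2, ω.1.2 + ω.1.1 + ω.2.1))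
        ((((letterLaw σs σn σz κ).map fun ω => ω.1.2 + ω.1.1 + ω.2.1 + ω.2.2).prod
          (gaussianReal 0 (bwdVar Q (σn ^ 2).toNNReal (σz ^ 2).toNNReal))).map
          fun p => (p.1, bwdSlope Q (σn ^ 2).toNNReal (σz ^ 2).toNNReal * p.1 + p.2))
        / ENNReal.ofReal (Real.log 2) + letterCondInfo σs σn σz κ =
      bwdDiv Q (σn ^ 2).toNNReal (σz ^ 2).toNNReal 1
        (∫ p, (p.1 + p.2) ^ 2 ∂(inputStateLaw σs κ)) / ENNReal.ofReal (Real.log 2) := by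
  have : IsProbabilityMeasure (inputStateLaw σs κ) := Measure.isProbabilityMeasure_map (by fun_prop)
  set P := (inputStateLaw σs κ).prod
    ((gauss σn).prod (gaussianReal 0 (σz ^ 2 - σn ^ 2).toNNReal)) with hP
  have h := add_klDiv_condDistrib_degraded (inputStateLaw σs κ) (P := P) hQ
    (Real.toNNReal_pos.2 (by positivity : 0 < σn ^ 2)) (coe_toNNReal_degraded hdeg)
    (w := fun p => p.1 + p.2) (by fun_prop) hw hP
  have hlaw : P = (letterLaw σs σn σz κ).map fun ω => ((ω.1.2, ω.1.1), ω.2) := by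
    have h1 := Measure.map_prod_map (gauss σs ⊗ₘ κ)
      ((gauss σn).prod (gaussianReal 0 (σz ^ 2 - σn ^ 2).toNNReal)) (f := Prod.swap) (g := id)
      measurable_swap measurable_id
    rw [Measure.map_id] at h1
    exact h1
  have hmap : ∀ {γ : Type} [MeasurableSpace γ] {g : (ℝ × ℝ) × ℝ × ℝ → γ}, Measurable g →
      P.map g = (letterLaw σs σn σz κ).map fun ω => g ((ω.1.2, ω.1.1), ω.2) := by
    intro γ _ g hg
    rw [hlaw, Measure.map_map hg (by fun_prop)]
    rfl
  -- Regular conditional distributions are determined only almost everywhere, so the change of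
  -- sample space compares the joint laws they generate and then uses uniqueness of disintegration.
  have hcond : ∀ {γ : Type} [MeasurableSpace γ] [StandardBorelSpace γ] [Nonempty γ]
      {g : (ℝ × ℝ) × ℝ × ℝ → γ}, Measurable g →
      (P.map fun ω => ω.1.1 + ω.1.2 + ω.2.1 + ω.2.2) ⊗ₘ
        condDistrib g (fun ω => ω.1.1 + ω.1.2 + ω.2.1 + ω.2.2) P =
      (P.map fun ω => ω.1.1 + ω.1.2 + ω.2.1 + ω.2.2) ⊗ₘ
        condDistrib (fun ω => g ((ω.1.2, ω.1.1), ω.2))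
          (fun ω => ω.1.2 + ω.1.1 + ω.2.1 + ω.2.2) (letterLaw σs σn σz κ) := by
    intro γ _ _ _ g hg
    rw [compProd_map_condDistrib hg.aemeasurable, hmap (by fun_prop), hmap (by fun_prop),
      compProd_map_condDistrib (by fun_prop)]
  have hprod := Kernel.ae_eq_of_compProd_eq (hcond (g := fun ω => ω.1) (by fun_prop))
  have hprod2 := Kernel.ae_eq_of_compProd_eq
    (hcond (g := fun ω => ω.1.1 + ω.1.2 + ω.2.1) (by fun_prop))
  have hcp : (P.map fun ω => ω.1.1 + ω.1.2 + ω.2.1 + ω.2.2) ⊗ₘ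
      (condDistrib (fun ω => ω.1) (fun ω => ω.1.1 + ω.1.2 + ω.2.1 + ω.2.2) P ×ₖ
        condDistrib (fun ω => ω.1.1 + ω.1.2 + ω.2.1)
          (fun ω => ω.1.1 + ω.1.2 + ω.2.1 + ω.2.2) P) =
      (P.map fun ω => ω.1.1 + ω.1.2 + ω.2.1 + ω.2.2) ⊗ₘ
      (condDistrib (fun ω => (ω.1.2, ω.1.1)) (fun ω => ω.1.2 + ω.1.1 + ω.2.1 + ω.2.2)
          (letterLaw σs σn σz κ) ×ₖ
        condDistrib (fun ω => ω.1.2 + ω.1.1 + ω.2.1)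
          (fun ω => ω.1.2 + ω.1.1 + ω.2.1 + ω.2.2) (letterLaw σs σn σz κ)) := by
    refine Measure.compProd_congr ?_
    filter_upwards [hprod, hprod2] with z h1 h2
    rw [Kernel.prod_apply, Kernel.prod_apply, h1, h2]
  rw [hcp, hmap (by fun_prop), hmap (by fun_prop), hmap (by fun_prop)] at h
  rw [letterCondInfo, condMutualInfo, ← ENNReal.add_div, ← h]

lemma inputStateLaw_power (hσs : 0 < σs) (hP : 0 ≤ P) (κ : Kernel ℝ ℝ) [IsMarkovKernel κ]
    (h : letterPower σs κ ≤ ENNReal.ofReal P) :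
    MemLp (fun p => p.1 + p.2) 2 (inputStateLaw σs κ) ∧
      ∫ p, (p.1 + p.2) ^ 2 ∂(inputStateLaw σs κ) ≤ (σs + Real.sqrt P) ^ 2 := by
  have hX : ∑ _i : Unit, ∫⁻ p, ENNReal.ofReal (p.1 ^ 2) ∂(inputStateLaw σs κ) ≤
      ENNReal.ofReal P := by
    rw [Finset.univ_unique, Finset.sum_singleton, inputStateLaw,
      lintegral_map (by fun_prop) (by fun_prop)]
    exact h
  obtain ⟨hX2, hXP⟩ := memLp_of_sum_lintegral_le (ι := Unit) (inputStateLaw σs κ)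
    (X := fun p _ => p.1) (by fun_prop) hP hX
  have hsnd : (inputStateLaw σs κ).map Prod.snd = gaussianReal 0 (σs ^ 2).toNNReal := by
    rw [inputStateLaw, Measure.map_map (by fun_prop) (by fun_prop)]
    exact Measure.fst_compProd _ _
  have hmp : MeasurePreserving Prod.snd (inputStateLaw σs κ) (gauss σs) := ⟨measurable_snd, hsnd⟩
  have hS : MemLp (fun p => p.2) 2 (inputStateLaw σs κ) :=
    (memLp_id_gaussianReal' 2 (by simp)).comp_measurePreserving hmp
  have hSσ : ∫ p, p.2 ^ 2 ∂(inputStateLaw σs κ) = σs ^ 2 := by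
    have h := integral_sq_gaussianReal (σs ^ 2).toNNReal
    rw [← hsnd, integral_map (by fun_prop) (Measurable.aestronglyMeasurable (by fun_prop)),
      Real.coe_toNNReal _ (sq_nonneg σs)] at h
    exact h
  have h1 := sum_integral_add_sq_le (ι := Unit) (inputStateLaw σs κ) hX2 (fun _ => hS)
    (n := 1) zero_le_one hP hσs.le (by simpa using hXP) (by simpa using hSσ)
  exact ⟨(hX2 ()).add hS, by simpa using h1⟩

lemma letterCondInfo_le (hσs : 0 < σs) (hσn : 0 < σn) (hP : 0 ≤ P) (hdeg : σn ^ 2 ≤ σz ^ 2)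
    (κ : Kernel ℝ ℝ) [IsMarkovKernel κ] (h : letterPower σs κ ≤ ENNReal.ofReal P) :
    letterCondInfo σs σn σz κ ≤
      ENNReal.ofReal (coherentRate σs P σn - coherentRate σs P σz) := by
  obtain ⟨hw, hwQ⟩ := inputStateLaw_power hσs hP κ h
  have hadd := add_letterCondInfo hσn hdeg (sq_nonneg (σs + Real.sqrt P)) κ hw
  have hb := bwdDiv_le (σs := σs) (P := P) (σn := σn) (σz := σz) 1
    (p := ∫ p, (p.1 + p.2) ^ 2 ∂(inputStateLaw σs κ)) (by simpa using hwQ)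
  rw [Nat.cast_one, one_mul] at hb
  exact le_add_self.trans (hadd.le.trans hb)

/-- The uncoded signal is Gaussian of power `Q = (σs + √P)²`, so it can be absorbed into the noise:
`(Y, N')` is an independent Gaussian pair with variances `Q + σn²` and `σz² - σn²`. -/
lemma letterLaw_uncoded_map (hσs : 0 < σs) :
    (letterLaw σs σn σz (letterUncoded σs P)).map
        (fun ω => (ω.1.2 + ω.1.1 + ω.2.1, ω.2.2)) =
      (gaussianReal 0 ((σs + Real.sqrt P) ^ 2 + σn ^ 2).toNNReal).prod
        (gaussianReal 0 (σz ^ 2 - σn ^ 2).toNNReal) := by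
  set δ := (σz ^ 2 - σn ^ 2).toNNReal
  have h1 : letterLaw σs σn σz (letterUncoded σs P) =
      ((gauss σs).prod ((gauss σn).prod (gaussianReal 0 δ))).map
        (fun p => ((p.1, Real.sqrt P / σs * p.1), p.2)) := by
    have h := Measure.map_prod_map (gauss σs) ((gauss σn).prod (gaussianReal 0 δ))
      (f := fun s => (s, Real.sqrt P / σs * s)) (g := id) (by fun_prop) measurable_id
    rw [Measure.map_id] at h
    rw [letterLaw, letterUncoded, Measure.compProd_deterministic, h]
    rfl
  have h2 := gaussianReal_prod_map_linear (Real.sqrt P / σs + 1) 1 (u := (σs ^ 2).toNNReal)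
    (v := (σn ^ 2).toNNReal) (r := ((σs + Real.sqrt P) ^ 2 + σn ^ 2).toNNReal) (by
      rw [Real.coe_toNNReal _ (sq_nonneg _), Real.coe_toNNReal _ (sq_nonneg _),
        Real.coe_toNNReal _ (by positivity)]
      field_simp
      ring)
  have h3 := Measure.map_prod_map ((gauss σs).prod (gauss σn)) (gaussianReal 0 δ)
    (f := fun p => (Real.sqrt P / σs + 1) * p.1 + 1 * p.2) (g := id) (by fun_prop) measurable_id
  rw [h2, Measure.map_id] at h3
  rw [h3, h1, ← Measure.prodAssoc_prod, Measure.map_map (by fun_prop) (by fun_prop),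
    Measure.map_map (by fun_prop) (by fun_prop)]
  congr 1
  ext ω : 1
  refine Prod.ext ?_ rfl
  simp [MeasurableEquiv.prodAssoc]
  ring

/-- The pair `(Y, Y + N')` is a degraded Gaussian pair with variances `Q + σn²` and `Q + σz²`. Its
own backward representation has exactly the slope and error variance of the reference channel. -/
lemma klDiv_letterUncoded_backward (hσs : 0 < σs) (hσn : 0 < σn) (hdeg : σn ^ 2 ≤ σz ^ 2) :
    klDiv ((letterLaw σs σn σz (letterUncoded σs P)).map fun ω =>
          (ω.1.2 + ω.1.1 + ω.2.1 + ω.2.2, ω.1.2 + ω.1.1 + ω.2.1))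
        ((((letterLaw σs σn σz (letterUncoded σs P)).map
            fun ω => ω.1.2 + ω.1.1 + ω.2.1 + ω.2.2).prod
          (gaussianReal 0
            (bwdVar ((σs + Real.sqrt P) ^ 2) (σn ^ 2).toNNReal (σz ^ 2).toNNReal))).map
          fun p => (p.1, bwdSlope ((σs + Real.sqrt P) ^ 2) (σn ^ 2).toNNReal (σz ^ 2).toNNReal
            * p.1 + p.2)) = 0 := by
  set Q := (σs + Real.sqrt P) ^ 2 with hQ
  set b := bwdSlope Q (σn ^ 2).toNNReal (σz ^ 2).toNNReal with hb
  set v := bwdVar Q (σn ^ 2).toNNReal (σz ^ 2).toNNReal with hv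
  set L := letterLaw σs σn σz (letterUncoded σs P) with hL
  have hQ0 : 0 ≤ Q := sq_nonneg _
  have hn2 : 0 < σn ^ 2 := by positivity
  have hz2 : 0 < σz ^ 2 := hn2.trans_le hdeg
  have hlaw := letterLaw_uncoded_map (σs := σs) (σn := σn) (σz := σz) (P := P) hσs
  rw [← hL, ← hQ] at hlaw
  have hbr : b = (Q + σn ^ 2) / (Q + σz ^ 2) := by
    rw [hb, bwdSlope, Real.coe_toNNReal _ hn2.le, Real.coe_toNNReal _ hz2.le]
  have hvr : (v : ℝ) = (Q + σn ^ 2) * (σz ^ 2 - σn ^ 2) / (Q + σz ^ 2) := by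
    rw [hv, coe_bwdVar hQ0 (Real.toNNReal_le_toNNReal hdeg), Real.coe_toNNReal _ hn2.le,
      Real.coe_toNNReal _ hz2.le]
  have hd := gaussianReal_degraded_eq (s := (Q + σn ^ 2).toNNReal) (t := (Q + σz ^ 2).toNNReal)
    (v := v) (δ := (σz ^ 2 - σn ^ 2).toNNReal) (a := b)
    (by rw [Real.coe_toNNReal _ (by positivity), Real.coe_toNNReal _ (by positivity),
          Real.coe_toNNReal _ (sub_nonneg.2 hdeg)]; ring)
    (by rw [Real.coe_toNNReal _ (by positivity), Real.coe_toNNReal _ (by positivity), hbr]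
        field_simp)
    (by rw [Real.coe_toNNReal _ (by positivity), Real.coe_toNNReal _ (by positivity), hbr, hvr]
        field_simp
        ring)
  rw [← hlaw, Measure.map_map (by fun_prop) (by fun_prop)] at hd
  have hpair : L.map (fun ω => (ω.1.2 + ω.1.1 + ω.2.1 + ω.2.2, ω.1.2 + ω.1.1 + ω.2.1)) =
      ((gaussianReal 0 (Q + σz ^ 2).toNNReal).prod (gaussianReal 0 v)).map
        fun p => (p.1, b * p.1 + p.2) :=
    map_comp_eq_of_map_eq (by fun_prop) (by fun_prop) hd measurable_swap
  have hZ : L.map (fun ω => ω.1.2 + ω.1.1 + ω.2.1 + ω.2.2) =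
      gaussianReal 0 (Q + σz ^ 2).toNNReal := by
    have h := map_comp_eq_of_map_eq (by fun_prop) (by fun_prop) hpair measurable_fst
    refine h.trans ?_
    change ((gaussianReal 0 (Q + σz ^ 2).toNNReal).prod (gaussianReal 0 v)).map Prod.fst = _
    rw [Measure.map_fst_prod]
    simp
  have : IsProbabilityMeasure (((gaussianReal 0 (Q + σz ^ 2).toNNReal).prod
      (gaussianReal 0 v)).map fun p => (p.1, b * p.1 + p.2)) :=
    Measure.isProbabilityMeasure_map (by fun_prop)
  rw [hpair, hZ, klDiv_self]

lemma inputStateLaw_uncoded_power (hσs : 0 < σs) :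
    ∫ p, (p.1 + p.2) ^ 2 ∂(inputStateLaw σs (letterUncoded σs P)) = (σs + Real.sqrt P) ^ 2 := by
  rw [inputStateLaw, letterUncoded, Measure.compProd_deterministic,
    Measure.map_map (by fun_prop) (by fun_prop), integral_map (by fun_prop)
      (Measurable.aestronglyMeasurable (by fun_prop))]
  have : ∀ x : ℝ, ((Prod.swap ∘ fun a => (a, Real.sqrt P / σs * a)) x).1 +
      ((Prod.swap ∘ fun a => (a, Real.sqrt P / σs * a)) x).2 = (Real.sqrt P / σs + 1) * x := by
    intro x; simp; ring
  simp only [this, mul_pow]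
  rw [integral_const_mul, integral_sq_gaussianReal, Real.coe_toNNReal _ (sq_nonneg σs)]
  field_simp
  ring

lemma letterPower_uncoded (hσs : 0 < σs) (hP : 0 ≤ P) :
    letterPower σs (letterUncoded σs P) = ENNReal.ofReal P := by
  rw [letterPower, letterUncoded, Measure.compProd_deterministic,
    lintegral_map (by fun_prop) (by fun_prop)]
  have hint : Integrable (fun x => (Real.sqrt P / σs * x) ^ 2) (gauss σs) := by
    simp only [mul_pow]
    exact (integrable_sq_gaussianReal _).const_mul _
  rw [← ofReal_integral_eq_lintegral_ofReal hint (ae_of_all _ fun _ => sq_nonneg _)]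
  simp only [mul_pow]
  rw [integral_const_mul, integral_sq_gaussianReal, Real.coe_toNNReal _ (sq_nonneg σs), div_pow,
    Real.sq_sqrt hP]
  congr 1
  field_simp

lemma letterCondInfo_uncoded (hσs : 0 < σs) (hσn : 0 < σn) (hP : 0 ≤ P)
    (hdeg : σn ^ 2 ≤ σz ^ 2) :
    letterCondInfo σs σn σz (letterUncoded σs P) =
      ENNReal.ofReal (coherentRate σs P σn - coherentRate σs P σz) := by
  obtain ⟨hw, -⟩ := inputStateLaw_power hσs hP _ (letterPower_uncoded hσs hP).le
  have hadd := add_letterCondInfo hσn hdeg (sq_nonneg (σs + Real.sqrt P)) _ hw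
  rw [klDiv_letterUncoded_backward hσs hσn hdeg, ENNReal.zero_div, zero_add] at hadd
  rw [hadd, inputStateLaw_uncoded_power hσs, bwdDiv, half_log_ratio_eq]
  simp only [Nat.cast_one, one_mul, sub_self, mul_zero, add_zero]
  exact ofReal_mul_log_two_div _

/-! ### The achievable region: converse and attainment -/

/-- Every achievable pair has difference at most the coherent rate difference. -/
lemma sub_le_of_mem_achievableRegion (hσs : 0 < σs) (hσn : 0 < σn) (hP : 0 ≤ P)
    (hdeg : σn ^ 2 ≤ σz ^ 2) {ν : Measure (ℝ × ℝ)} [IsProbabilityMeasure ν]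
    (hN : ν.fst = gaussianReal 0 (σn ^ 2).toNNReal)
    (hNz : ν.snd = gaussianReal 0 (σz ^ 2).toNNReal) {R : ℝ × ℝ}
    (hR : R ∈ achievableRegion σs ν P) :
    R.1 - R.2 ≤ coherentRate σs P σn - coherentRate σs P σz := by
  obtain ⟨κ, hκ, h⟩ := hR
  refine le_of_forall_pos_le_add fun ε hε => ?_
  -- One block length suffices, since the converse holds for every `n ≥ 1`; the tolerance `ε / 2` is
  -- spent once on each rate.
  obtain ⟨n, ⟨hpow, ha, hl⟩, hn⟩ := ((h (ε / 2) (half_pos hε)).and (eventually_ge_atTop 1)).exists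
  have := hκ n
  have hle := amplificationRate_le hσs hσn hP hdeg hN hNz hn (κ n) hpow
  have hC : 0 ≤ coherentRate σs P σn - coherentRate σs P σz := by
    rw [coherentRate, coherentRate, ← mul_sub]
    refine mul_nonneg (by norm_num) (sub_nonneg.2 ?_)
    refine Real.logb_le_logb_of_le one_lt_two (by positivity) ?_
    gcongr
  set a := amplificationRate σs ν (κ n)
  set l := leakageRate σs ν (κ n)
  -- The achievability condition bounds the leakage by a real number, and the converse then makes
  -- the amplification rate finite, so the comparison can be made in the reals.
  have hl_top : l ≠ ∞ := by
    rintro h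
    rw [h, EReal.coe_ennreal_top, top_le_iff] at hl
    exact EReal.coe_ne_top _ hl
  have ha_top : a ≠ ∞ := ne_top_of_le_ne_top (ENNReal.add_ne_top.2 ⟨hl_top, by simp⟩) hle
  have hle' : a.toReal ≤ l.toReal + (coherentRate σs P σn - coherentRate σs P σz) := by
    have := ENNReal.toReal_mono (ENNReal.add_ne_top.2 ⟨hl_top, by simp⟩) hle
    rwa [ENNReal.toReal_add hl_top (by simp), ENNReal.toReal_ofReal hC] at this
  rw [← EReal.coe_ennreal_toReal ha_top, EReal.coe_le_coe_iff] at ha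
  rw [← EReal.coe_ennreal_toReal hl_top, EReal.coe_le_coe_iff] at hl
  linarith

lemma coherentRate_mem_achievableRegion (hσs : 0 < σs) (hσn : 0 < σn) (hσz : 0 < σz)
    (hP : 0 ≤ P) {ν : Measure (ℝ × ℝ)} [IsProbabilityMeasure ν]
    (hN : ν.fst = gaussianReal 0 (σn ^ 2).toNNReal)
    (hNz : ν.snd = gaussianReal 0 (σz ^ 2).toNNReal) :
    (coherentRate σs P σn, coherentRate σs P σz) ∈ achievableRegion σs ν P := by
  refine ⟨uncoded σs P, fun n => inferInstance, fun ε hε => ?_⟩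
  filter_upwards [eventually_ge_atTop 1] with n hn
  refine ⟨averagePower_uncoded_le hσs hP hn, ?_, ?_⟩
  · rw [amplificationRate_uncoded hσs P hn hσn hN, EReal.coe_ennreal_ofReal,
      max_eq_left (coherentRate_nonneg _ _ _), EReal.coe_le_coe_iff]
    linarith
  · rw [leakageRate_uncoded hσs P hn hσz hNz, EReal.coe_ennreal_ofReal,
      max_eq_left (coherentRate_nonneg _ _ _), EReal.coe_le_coe_iff]
    linarith

end

end StateAmplification

theorem mainTheorem11 (σs σn σz P : ℝ) (hσs : 0 < σs) (hσn : 0 < σn) (hσz : 0 < σz)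
    (hP : 0 ≤ P) (hdeg : σn ^ 2 ≤ σz ^ 2)
    (ν : Measure (ℝ × ℝ)) [IsProbabilityMeasure ν]
    (hN : ν.fst = gaussianReal 0 (σn ^ 2).toNNReal)
    (hNz : ν.snd = gaussianReal 0 (σz ^ 2).toNNReal) :
    -- the value of the differential amplification capacity
    StateAmplification.diffAmpCapacity σs ν P =
        ((1 / 2 * Real.logb 2 (1 + (σs + Real.sqrt P) ^ 2 / σn ^ 2)
          - 1 / 2 * Real.logb 2 (1 + (σs + Real.sqrt P) ^ 2 / σz ^ 2) : ℝ) : EReal) ∧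
    -- the supremum is attained, by the uncoded scheme, at every block length
    (StateAmplification.coherentRate σs P σn, StateAmplification.coherentRate σs P σz) ∈
        StateAmplification.achievableRegion σs ν P ∧
    (∀ n : ℕ, 1 ≤ n →
      StateAmplification.averagePower σs ν (StateAmplification.uncoded σs P n)
          ≤ ENNReal.ofReal P ∧
      StateAmplification.amplificationRate σs ν (StateAmplification.uncoded σs P n)
          = ENNReal.ofReal (StateAmplification.coherentRate σs P σn) ∧
      StateAmplification.leakageRate σs ν (StateAmplification.uncoded σs P n)
          = ENNReal.ofReal (StateAmplification.coherentRate σs P σz)) ∧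
    -- it equals the largest value of the single-letter bound `I(X,S;Y|Z)`, at the uncoded input
    ((∀ (κ : Kernel ℝ ℝ) [IsMarkovKernel κ],
        StateAmplification.letterPower σs κ ≤ ENNReal.ofReal P →
        StateAmplification.letterCondInfo σs σn σz κ ≤
          ENNReal.ofReal (StateAmplification.coherentRate σs P σn
            - StateAmplification.coherentRate σs P σz)) ∧
      StateAmplification.letterPower σs (StateAmplification.letterUncoded σs P)
          ≤ ENNReal.ofReal P ∧
      StateAmplification.letterCondInfo σs σn σz (StateAmplification.letterUncoded σs P) =
        ENNReal.ofReal (StateAmplification.coherentRate σs P σn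
          - StateAmplification.coherentRate σs P σz)) := by
  have hmem := StateAmplification.coherentRate_mem_achievableRegion hσs hσn hσz hP hN hNz
  refine ⟨?_, hmem, fun n hn => ⟨StateAmplification.averagePower_uncoded_le hσs hP hn,
    StateAmplification.amplificationRate_uncoded hσs P hn hσn hN,
    StateAmplification.leakageRate_uncoded hσs P hn hσz hNz⟩,
    fun κ _ h => StateAmplification.letterCondInfo_le hσs hσn hP hdeg κ h,
    (StateAmplification.letterPower_uncoded hσs hP).le,
    StateAmplification.letterCondInfo_uncoded hσs hσn hP hdeg⟩
  refine le_antisymm (sSup_le ?_) (le_sSup ⟨_, hmem, rfl⟩)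
  rintro _ ⟨R, hR, rfl⟩
  exact EReal.coe_le_coe_iff.2
    (StateAmplification.sub_le_of_mem_achievableRegion hσs hσn hP hdeg hN hNz hR)
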